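/- Let $n$ be the security parameter and let $U_n\subseteq\{0,1\}^*$ be the universe of set elements. All inputs are sets of elements of $U_n$ whose total size is polynomial in $n$. Indistinguishability $\stackrel{c}{\equiv}$ is against non-uniform polynomial-time distinguishers, uniformly over such inputs, and "with overwhelming probability" means except with probability negligible in $n$. **G-PSI.** There are two groups of $k$ clients, $\mathcal C_{g,1},\dots,\mathcal C_{g,k}$ for $g\in\{0,1\}$, with sets $S_{g,i}$ such that the sets of the same group are pairwise disjoint, and a third party $TP$ with input $\emptyset$. The functionality gives each $\mathcal C_{g,i}$ the vector $\vec v_{g,i}=[S_{g,i}\cap S_{1-g,1},\dots,S_{g,i}\cap S_{1-g,k}]$ and gives $\emptyset$ to $TP$. A protocol *securely realizes G-PSI* with leakage function $\mathcal L$ if with overwhelming probability every party outputs what the functionality prescribes, and there are probabilistic polynomial-time (PPT) simulators with $\{Sim_{\mathcal C_{g,i}}(1^n,S_{g,i},\vec v_{g,i})\}_S\stackrel{c}{\equiv}\{View_{\mathcal C_{g,i}}(S)\}_S$ for every client and $\{Sim_{TP}(1^n,\emptyset,\emptyset,\mathcal L(S))\}_S\stackrel{c}{\equiv}\{View_{TP}(S)\}_S$.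 The view of a (semi-honest) party consists of its input, its coins and the messages it receives. **P-MPD.** There are $m$ clients $\mathcal C_1,\dots,\mathcal C_m$ with sets $S_1,\dots,S_m$. A P-MPD functionality $f$ maps $(S_1,\dots,S_m)$ to $(S_1',\dots,S_m')$ with $S_i'\subseteq S_i$ such that the concatenation of $S_1',\dots,S_m'$ as multisets is $\bigcup_i S_i$ (so the $S_i'$ are disjoint and have union $\bigcup_i S_i$). The leakage function $\mathcal W$ gives client $i$ the set $Q_i$ of all triples $(r,i,l)$ with $l\ne i$ and $r\in S_i\cap S_l$. A protocol *securely realizes P-MPD* with leakage $\mathcal W$ against semi-honest adversaries if there is a P-MPD functionality $f$ such that with overwhelming probability every client $i$ outputs its component $S_i'$ of $f(S_1,\dots,S_m)$, and for every client $i$ there is a PPT simulator with $\{Sim_{\mathcal C_i}(1^n,S_i,S_i',Q_i)\}_S\stackrel{c}{\equiv}\{View_{\mathcal C_i}(S)\}_S$. **EP-MPD.** Let $m=2^z$ and, for each $k$, let EG-PSI be a protocol for two groups of $k$ clients and a third party. At each level $d=1,\dots,\log_2 m$ the clients, in the order of their indices, form $m/2^d$ clusters of $2^d$ consecutive clients;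 the first $2^{d-1}$ clients of a cluster are its group 0 and the others its group 1. Each cluster runs EG-PSI, with fresh independent coins, on the current sets of its clients, and then each client of group 0 removes from its set every element that occurs in the vector it received. The output of a client is its set after the last level; its view consists of its input set, its views in the instances of EG-PSI it took part in, and its outputs from them. **Theorem 3.** Suppose that, for every group size $k=2^{d-1}$ with $1\le d\le\log_2 m$, EG-PSI is a protocol with PPT parties that securely realizes G-PSI (with some leakage function to the third party). Then EP-MPD on $m$ clients securely realizes P-MPD with leakage $\mathcal W$ against semi-honest adversaries. -/

import Mathlib

namespace EPMPD

/-! ## Machine model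

Data are binary trees, programs are while-programs over trees, and every elementary step costs the
size of the tree it works on.  The cost of a computation bounds the size of everything it writes, and
each step is a linear-size tree manipulation, so that polynomial cost here is polynomial time on
Turing machines. -/

/-- Binary trees: the strings of the machine model. -/
inductive Data : Type
  | nil : Data
  | node (a b : Data) : Data
  deriving DecidableEq

namespace Data

/-- Number of nodes (leaves included). -/
def size : Data → ℕ
  | nil => 1
  | node a b => 1 + a.size + b.size

/-- Left subtree. -/
def hd : Data → Data
  | nil => nil
  | node a _ => a

/-- Right subtree. -/
def tl : Data → Data
  | nil => nil
  | node _ b => b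

/-- The entries of a tree read as a list. -/
def toList : Data → List Data
  | nil => []
  | node a b => a :: b.toList

/-- The list with the given entries, as a tree. -/
def ofList : List Data → Data
  | [] => nil
  | a :: l => node a (ofList l)

end Data

/-- While-programs over trees. -/
inductive Prog : Type
  | id : Prog
  | nil : Prog
  | hd : Prog
  | tl : Prog
  | eq : Prog
  | pair (f g : Prog) : Prog
  | comp (g f : Prog) : Prog
  | ite (c f g : Prog) : Prog
  | loop (f : Prog) : Prog

/-- `p.Runs x y t`: on input `x` the program `p` halts with output `y` at cost `t`.  `eq` compares the
two components of a pair; `ite c f g` runs `f` if `c` returns a nonempty tree and `g` otherwise;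
`loop f` repeats `f` as long as the first component of the current tree is nonempty. -/
inductive Prog.Runs : Prog → Data → Data → ℕ → Prop
  | id (x : Data) : Runs .id x x x.size
  | nil (x : Data) : Runs .nil x .nil x.size
  | hd (x : Data) : Runs .hd x x.hd x.size
  | tl (x : Data) : Runs .tl x x.tl x.size
  | eq (x : Data) :
      Runs .eq x (if x.hd = x.tl then .node .nil .nil else .nil) (x.size + 2)
  | pair {f g : Prog} {x y z : Data} {s t : ℕ} :
      Runs f x y s → Runs g x z t → Runs (.pair f g) x (.node y z) (s + t + 1)
  | comp {f g : Prog} {x y z : Data} {s t : ℕ} :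
      Runs f x y s → Runs g y z t → Runs (.comp g f) x z (s + t + 1)
  | iteTrue {c f g : Prog} {x b y : Data} {s t : ℕ} :
      Runs c x b s → b ≠ .nil → Runs f x y t → Runs (.ite c f g) x y (s + t + 1)
  | iteFalse {c f g : Prog} {x b y : Data} {s t : ℕ} :
      Runs c x b s → b = .nil → Runs g x y t → Runs (.ite c f g) x y (s + t + 1)
  | loopDone {f : Prog} {x : Data} :
      x.hd = .nil → Runs (.loop f) x x x.size
  | loopStep {f : Prog} {x y z : Data} {s t : ℕ} :
      x.hd ≠ .nil → Runs f x y s → Runs (.loop f) y z t → Runs (.loop f) x z (x.size + s + t)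

/-- Functions on trees that some program computes in polynomial time. -/
def IsPolyTime (f : Data → Data) : Prop :=
  ∃ (p : Prog) (q : Polynomial ℕ), ∀ x : Data, ∃ t : ℕ, t ≤ q.eval x.size ∧ p.Runs x (f x) t

/-! ## Encodings -/

/-- A fixed representation of the elements of a type as trees. -/
class Encode (α : Type) where
  enc : α → Data

open Encode (enc)

instance : Encode Data := ⟨fun x => x⟩

instance : Encode Bool := ⟨fun b => if b then .node .nil .nil else .nil⟩

instance {α : Type} [Encode α] : Encode (List α) := ⟨fun l => .ofList (l.map enc)⟩

/-- Natural numbers are written in unary. -/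
instance : Encode ℕ := ⟨fun n => .ofList (List.replicate n .nil)⟩

instance {n : ℕ} : Encode (Fin n) := ⟨fun i => enc (i : ℕ)⟩

instance {α β : Type} [Encode α] [Encode β] : Encode (α × β) := ⟨fun x => .node (enc x.1) (enc x.2)⟩

instance {α β : Type} [Encode α] [Encode β] : Encode (α ×ₗ β) :=
  ⟨fun x => .node (enc (ofLex x).1) (enc (ofLex x).2)⟩

/-- Vectors are written as lists. -/
instance {α : Type} [Encode α] {n : ℕ} : Encode (Fin n → α) := ⟨fun v => enc (List.ofFn v)⟩

/-- A finite set is written as the increasing list of its elements. -/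
instance {α : Type} [Encode α] [LinearOrder α] : Encode (Finset α) := ⟨fun s => enc s.sort⟩

/-! ## Probability, polynomial bounds, indistinguishability -/

/-- Probability of an event. -/
noncomputable def prob {α : Type} (X : PMF α) (E : Set α) : ℝ := (X.toOuterMeasure E).toReal

/-- Negligible functions of the security parameter. -/
def Negligible (f : ℕ → ℝ) : Prop :=
  Asymptotics.SuperpolynomialDecay Filter.atTop (fun n : ℕ => (n : ℝ)) f

/-- Polynomially bounded functions of the security parameter. -/
def PolyBounded (f : ℕ → ℕ) : Prop := ∃ q : Polynomial ℕ, ∀ n, f n ≤ q.eval n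

/-- Probabilistic polynomial-time algorithms: on input `x` the algorithm tosses `coins x` coins and
then runs a polynomial-time function on `x` and the outcome.  The number of coins is itself computed
in polynomial time, hence polynomially bounded. -/
structure PPT where
  coins : Data → ℕ
  run : Data → Data
  coins_polyTime : IsPolyTime fun x => enc (coins x)
  run_polyTime : IsPolyTime run

/-- Output distribution of a probabilistic algorithm. -/
noncomputable def PPT.dist (A : PPT) (x : Data) : PMF Data :=
  (PMF.uniformOfFintype (Fin (A.coins x) → Bool)).map fun r => A.run (enc (x, r))

/-- Non-uniform polynomial-time distinguishers: a polynomial-time function with an advice of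
polynomial size for each value of the security parameter. -/
structure Distinguisher where
  advice : ℕ → Data
  run : Data → Data
  advice_polyBounded : PolyBounded fun n => (advice n).size
  run_polyTime : IsPolyTime run

/-- The samples that a distinguisher accepts. -/
def Distinguisher.accepts (D : Distinguisher) (n : ℕ) : Set Data :=
  {y | D.run (enc (n, D.advice n, y)) ≠ .nil}

/-- Families of inputs of polynomial size, each of them admissible. -/
def IsInputFamily {ι : Type} [Encode ι] (adm : ℕ → ι → Prop) (s : ℕ → ι) : Prop :=
  (∀ n, adm n (s n)) ∧ PolyBounded fun n => (enc (s n)).size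

/-- Computational indistinguishability of two ensembles of distributions that are indexed by the
security parameter and by the admissible inputs. -/
def CompIndist {ι : Type} [Encode ι] (adm : ℕ → ι → Prop) (X Y : ℕ → ι → PMF Data) : Prop :=
  ∀ (D : Distinguisher) (s : ℕ → ι), IsInputFamily adm s →
    Negligible fun n => |prob (X n (s n)) (D.accepts n) - prob (Y n (s n)) (D.accepts n)|

/-! ## Executions, correctness, simulatability -/

/-- Joint distribution of the view and the output of each party, for each value of the security
parameter and each input. -/
abbrev Execution (P ι : Type) : Type := ℕ → ι → PMF (P → Data × Data)

/-- Except with negligible probability, every party outputs what the functionality prescribes. -/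
def Execution.Computes {P ι : Type} [Encode ι] (E : Execution P ι) (adm : ℕ → ι → Prop)
    (f : ι → P → Data) : Prop :=
  ∀ s : ℕ → ι, IsInputFamily adm s →
    Negligible fun n => prob (E n (s n)) {o | ¬ ∀ p, (o p).2 = f (s n) p}

/-- The view of party `p` can be simulated in probabilistic polynomial time from the security
parameter and the data `known`. -/
def Execution.Simulatable {P ι : Type} [Encode ι] (E : Execution P ι) (adm : ℕ → ι → Prop) (p : P)
    (known : ι → Data) : Prop :=
  ∃ Sim : PPT, CompIndist adm (fun n s => Sim.dist (enc (n, known s)))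
    (fun n s => (E n s).map fun o => (o p).1)

/-! ## Protocols -/

/-- A synchronous message-passing protocol over secure pairwise channels, with honest-but-curious
parties `P`.  `coins p` is the number of coins of party `p` as a function of the security parameter
and its input; `msg p q` maps the current view of `p` to the message that `p` sends to `q` in the next
round; `out p` maps the final view of `p` to its output. -/
structure Protocol (P : Type) where
  rounds : ℕ → ℕ
  coins : P → Data → ℕ
  msg : P → P → Data → Data
  out : P → Data → Data

namespace Protocol

variable {P : Type} [FinEnum P] (Γ : Protocol P)

/-- The coins of all parties, for security parameter `n` and inputs `x`. -/
abbrev Coins (n : ℕ) (x : P → Data) : Type := (p : P) → Fin (Γ.coins p (enc (n, x p))) → Bool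

/-- A party's view: security parameter, input, coins, and, round by round, the messages received. -/
def mkView (n : ℕ) (x : P → Data) (r : Γ.Coins n x) (received : P → List Data) (p : P) : Data :=
  enc (n, x p, r p, received p)

/-- The messages each party has received in the first `t` rounds: one entry per round, which lists
the messages of that round by sender. -/
def received (n : ℕ) (x : P → Data) (r : Γ.Coins n x) : ℕ → P → List Data
  | 0, _ => []
  | t + 1, p => received n x r t p ++
      [enc ((FinEnum.toList P).map fun q => Γ.msg q p (Γ.mkView n x r (received n x r t) q))]

/-- The view of each party at the end of the execution. -/
def view (n : ℕ) (x : P → Data) (r : Γ.Coins n x) (p : P) : Data :=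
  Γ.mkView n x r (Γ.received n x r (Γ.rounds n)) p

/-- View and output of each party at the end of the execution. -/
def outcome (n : ℕ) (x : P → Data) (r : Γ.Coins n x) (p : P) : Data × Data :=
  (Γ.view n x r p, Γ.out p (Γ.view n x r p))

/-- The random execution of the protocol. -/
noncomputable def exec : Execution P (P → Data) := fun n x =>
  (PMF.uniformOfFintype (Γ.Coins n x)).map (Γ.outcome n x)

/-- All parties run in probabilistic polynomial time: every step is a polynomial-time function, and
the views, which contain the coins and all messages received, stay polynomially bounded. -/
structure IsPPT : Prop where
  coins : ∀ p, IsPolyTime fun x => enc (Γ.coins p x)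
  msg : ∀ p q, IsPolyTime (Γ.msg p q)
  out : ∀ p, IsPolyTime (Γ.out p)
  view : ∃ b : Polynomial ℕ, ∀ (n : ℕ) (x : P → Data) (r : Γ.Coins n x) (p : P),
    (Γ.view n x r p).size ≤ b.eval (n + ∑ q, (x q).size)

end Protocol

/-! ## Group private set intersection -/

/-- Set elements are bit strings. -/
abbrev Elem : Type := List Bool

/-- The parties of G-PSI: client `i` of group `g` is `some (g, i)`, the third party is `none`. -/
abbrev GParty (k : ℕ) : Type := Option (Fin 2 × Fin k)

/-- The sets of the clients of the two groups. -/
abbrev GSets (k : ℕ) : Type := Fin 2 → Fin k → Finset Elem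

/-- All elements come from the universe, and clients of the same group have disjoint sets. -/
def GSets.Admissible (U : ℕ → Set Elem) {k : ℕ} (n : ℕ) (S : GSets k) : Prop :=
  (∀ g i, ∀ e ∈ S g i, e ∈ U n) ∧ ∀ g, Pairwise fun i l => Disjoint (S g i) (S g l)

/-- Each client's vector of intersections with the sets of the other group (`1 - g` in `Fin 2`). -/
def gpsiVec {k : ℕ} (S : GSets k) (g : Fin 2) (i : Fin k) : Fin k → Finset Elem :=
  fun l => S g i ∩ S (1 - g) l

/-- The inputs: each client has its set, the third party has the empty set. -/
def gpsiInput {k : ℕ} (S : GSets k) : GParty k → Data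
  | some (g, i) => enc (S g i)
  | none => enc (∅ : Finset Elem)

/-- The functionality: each client gets its vector of intersections, the third party the empty set. -/
def gpsi {k : ℕ} (S : GSets k) : GParty k → Data
  | some (g, i) => enc (gpsiVec S g i)
  | none => enc (∅ : Finset Elem)

/-- The protocol `Γ` securely realizes G-PSI with leakage `L` to the third party: it computes the
functionality, each client's view is simulated from its input and output, and the third party's view
from its empty input and output and the leakage. -/
def SecurelyRealizesGPSI (U : ℕ → Set Elem) {k : ℕ} (L : GSets k → Data)
    (Γ : Protocol (GParty k)) : Prop :=
  let E : Execution (GParty k) (GSets k) := fun n S => Γ.exec n (gpsiInput S)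
  let adm : ℕ → GSets k → Prop := GSets.Admissible U
  E.Computes adm gpsi ∧
  (∀ g i, E.Simulatable adm (some (g, i)) fun S => enc (S g i, gpsiVec S g i)) ∧
  E.Simulatable adm none fun S => enc ((∅ : Finset Elem), (∅ : Finset Elem), L S)

/-! ## Multi-party deduplication -/

/-- The sets of the `m` clients. -/
abbrev Sets (m : ℕ) : Type := Fin m → Finset Elem

/-- All elements come from the universe. -/
def Sets.Admissible (U : ℕ → Set Elem) {m : ℕ} (n : ℕ) (S : Sets m) : Prop :=
  ∀ i, ∀ e ∈ S i, e ∈ U n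

/-- `S'` is a deduplication of `S`: each client keeps part of its set, and the concatenation (as
multisets) of the new sets is the union of the old ones. -/
def IsDedup {m : ℕ} (S S' : Sets m) : Prop :=
  (∀ i, S' i ⊆ S i) ∧ ∑ i, (S' i).val = (Finset.univ.biUnion S).val

/-- The triples `(r, i, l)` that make up the leakage. -/
abbrev Triple (m : ℕ) : Type := Elem ×ₗ (Fin m ×ₗ Fin m)

/-- The redundancy that each set has with all the other sets. -/
def redundancy {m : ℕ} (S : Sets m) : Sets m :=
  fun i => (S i).filter fun e => ∃ l, l ≠ i ∧ e ∈ S l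

/-- The leakage function: client `i` gets the triples `(r, i, l)` where `r ∈ R i` is a redundancy
between its set and the set of another client `l`. -/
def leakageW {m : ℕ} (S R : Sets m) (i : Fin m) : Finset (Triple m) :=
  (Finset.univ.erase i).biUnion fun l =>
    ((R i).filter fun r => r ∈ S i ∧ r ∈ S l).image fun r => toLex (r, toLex (i, l))

/-- An execution `E` securely realizes P-MPD with leakage `W`: it computes a deduplication
functionality `f`, and each client's view is simulated from its input, its output under `f` and its
share of the leakage. -/
def SecurelyRealizesPMPD (U : ℕ → Set Elem) {m : ℕ} (W : Sets m → Fin m → Finset (Triple m))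
    (E : Execution (Fin m) (Sets m)) : Prop :=
  let adm : ℕ → Sets m → Prop := Sets.Admissible U
  ∃ f : Sets m → Sets m, (∀ S, IsDedup S (f S)) ∧
    E.Computes adm (fun S i => enc (f S i)) ∧
    ∀ i, E.Simulatable adm i fun S => enc (S i, f S i, W S i)

/-! ## The tree-structured deduplication protocol

There are `2 ^ z` clients `0, …, 2 ^ z - 1`; the levels are numbered `d = 0, …, z - 1`.  At level `d`
there are `2 ^ z / 2 ^ (d + 1)` clusters of `2 ^ (d + 1)` consecutive clients; the first `2 ^ d` of
them form group `0` and the others group `1`. -/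

theorem member_lt {z d : ℕ} (c : Fin (2 ^ z / 2 ^ (d + 1))) (g : Fin 2) (l : Fin (2 ^ d)) :
    2 ^ (d + 1) * (c : ℕ) + 2 ^ d * (g : ℕ) + (l : ℕ) < 2 ^ z := by
  have h1 : 2 ^ (d + 1) * ((c : ℕ) + 1) ≤ 2 ^ z :=
    (Nat.mul_le_mul_left _ c.isLt).trans (Nat.mul_div_le _ _)
  have h2 : 2 ^ d * (g : ℕ) ≤ 2 ^ d * 1 := Nat.mul_le_mul_left _ (by omega)
  have h3 := l.isLt
  have h4 : 2 ^ (d + 1) = 2 ^ d * 2 := pow_succ 2 d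
  nlinarith

theorem cluster_lt {z d : ℕ} (hd : d < z) (i : Fin (2 ^ z)) :
    (i : ℕ) / 2 ^ (d + 1) < 2 ^ z / 2 ^ (d + 1) :=
  Nat.div_lt_div_of_lt_of_dvd (pow_dvd_pow 2 hd) i.isLt

/-- The client at position `l` of group `g` of cluster `c`. -/
def member {z d : ℕ} (c : Fin (2 ^ z / 2 ^ (d + 1))) (g : Fin 2) (l : Fin (2 ^ d)) : Fin (2 ^ z) :=
  ⟨2 ^ (d + 1) * c + 2 ^ d * g + l, member_lt c g l⟩

/-- The cluster of client `i`. -/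
def cluster {z d : ℕ} (hd : d < z) (i : Fin (2 ^ z)) : Fin (2 ^ z / 2 ^ (d + 1)) :=
  ⟨i / 2 ^ (d + 1), cluster_lt hd i⟩

/-- The group of client `i` in its cluster. -/
def group {z : ℕ} (d : ℕ) (i : Fin (2 ^ z)) : Fin 2 :=
  ⟨i / 2 ^ d % 2, Nat.mod_lt _ Nat.two_pos⟩

/-- The position of client `i` in its group. -/
def position {z : ℕ} (d : ℕ) (i : Fin (2 ^ z)) : Fin (2 ^ d) :=
  ⟨i % 2 ^ d, Nat.mod_lt _ (Nat.two_pow_pos d)⟩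

theorem member_cluster {z d : ℕ} (hd : d < z) (i : Fin (2 ^ z)) :
    member (cluster hd i) (group d i) (position d i) = i := by
  apply Fin.ext
  simp only [member, cluster, group, position]
  have h1 := Nat.div_add_mod (i : ℕ) (2 ^ d)
  have h2 := Nat.div_add_mod ((i : ℕ) / 2 ^ d) 2
  rw [Nat.div_div_eq_div_mul, ← pow_succ] at h2
  have h3 : 2 ^ (d + 1) = 2 ^ d * 2 := pow_succ 2 d
  calc 2 ^ (d + 1) * ((i : ℕ) / 2 ^ (d + 1)) + 2 ^ d * ((i : ℕ) / 2 ^ d % 2) + (i : ℕ) % 2 ^ d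
      = 2 ^ d * (2 * ((i : ℕ) / 2 ^ (d + 1)) + (i : ℕ) / 2 ^ d % 2) + (i : ℕ) % 2 ^ d := by
        rw [h3]; ring
    _ = i := by rw [h2, h1]

/-- Remove from the set every element that occurs in one of the lists of the vector `v`. -/
def update (S : Finset Elem) (v : Data) : Finset Elem :=
  S.filter fun e => ∀ w ∈ v.toList, enc e ∉ w.toList

/-- The state of the clients between two levels: current sets, and the views and outputs from the
instances of EG-PSI run so far, by level. -/
structure State (z : ℕ) where
  sets : Sets (2 ^ z)
  views : Fin (2 ^ z) → List Data
  outputs : Fin (2 ^ z) → List Data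

section

variable {z : ℕ} (Γ : (k : ℕ) → Protocol (GParty k)) (n : ℕ)

/-- The inputs to the instance of EG-PSI in cluster `c` at level `d`. -/
def clusterInput (d : ℕ) (st : State z) (c : Fin (2 ^ z / 2 ^ (d + 1))) : GParty (2 ^ d) → Data :=
  gpsiInput fun g l => st.sets (member c g l)

/-- The end of level `d`, when `r c` are the coins used in cluster `c`. -/
def levelStep {d : ℕ} (hd : d < z) (st : State z)
    (r : (c : Fin (2 ^ z / 2 ^ (d + 1))) → (Γ (2 ^ d)).Coins n (clusterInput d st c)) : State z :=
  let o : Fin (2 ^ z) → Data × Data := fun i =>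
    (Γ (2 ^ d)).outcome n (clusterInput d st (cluster hd i)) (r (cluster hd i))
      (some (group d i, position d i))
  { sets := fun i => if group d i = 0 then update (st.sets i) (o i).2 else st.sets i
    views := fun i => st.views i ++ [(o i).1]
    outputs := fun i => st.outputs i ++ [(o i).2] }

/-- Level `d`: all clusters run EG-PSI, with independent uniform coins. -/
noncomputable def level {d : ℕ} (hd : d < z) (st : State z) : PMF (State z) :=
  (PMF.uniformOfFintype
    ((c : Fin (2 ^ z / 2 ^ (d + 1))) → (Γ (2 ^ d)).Coins n (clusterInput d st c))).map
      (levelStep Γ n hd st)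

/-- The state of the clients after the first `d` levels, when their initial sets are `S`. -/
noncomputable def levels (S : Sets (2 ^ z)) : (d : ℕ) → d ≤ z → PMF (State z)
  | 0, _ => PMF.pure ⟨S, fun _ => [], fun _ => []⟩
  | d + 1, hd => (levels S d (Nat.le_of_succ_le hd)).bind (level Γ n hd)

/-- The execution of EP-MPD on `2 ^ z` clients, where `Γ k` is the EG-PSI protocol for two groups of
`k` clients.  The view of a client consists of the security parameter, its set, its views in the
instances of EG-PSI (with its coins and the messages it received) and its outputs from them; its
output is its updated set. -/
noncomputable def epmpd (z : ℕ) : Execution (Fin (2 ^ z)) (Sets (2 ^ z)) := fun n S =>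
  (levels Γ n S z le_rfl).map fun st i =>
    (enc (n, S i, st.views i, st.outputs i), enc (st.sets i))

end

end EPMPD

open EPMPD

/-! If no instance of EG-PSI errs, the sets evolve deterministically: after `d` levels an element
remains exactly with its last owner in each block of `2 ^ d` consecutive clients (`idealSets`,
`idealSets_succ`). For `d = z` there is one block, so the last owner overall keeps the element, and
this is the deduplication `f`. The ideal sets within a group are disjoint, so they are admissible
inputs to G-PSI.

Correctness: as long as the sets are ideal, the next level produces ideal sets and vectors unless
some cluster errs. A union bound over clusters and a sum over the fixed number `z` of levels show
that the real execution is statistically close to one in which every instance runs on the ideal sets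
(`exists_statClose_levels`).

Privacy: in that ideal execution all inputs are fixed in advance, so the views of a client at
different levels are independent. For each of its own elements the leakage tells a client who else
owns it, hence where it is at each level; thus its ideal input and vector at every level are
computable in polynomial time (`exists_polyTime_ideal`) and can be fed to the simulators of EG-PSI.
The simulated views are joined by a hybrid argument (`EnsIndist.node`): the component that is kept
is fixed to a good sample and given to the distinguisher as advice, which is possible since views
have polynomial size. The outputs are attached last, being a function of input and leakage. -/

namespace EPMPD

open EPMPD.Encode (enc)
open scoped ENNReal

/-! ## Polynomial-time functions on trees -/

theorem Data.one_le_size (x : Data) : 1 ≤ x.size := by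
  cases x <;> simp only [Data.size] <;> omega

@[simp] theorem Data.hd_node (a b : Data) : (Data.node a b).hd = a := rfl

@[simp] theorem Data.tl_node (a b : Data) : (Data.node a b).tl = b := rfl

theorem Data.size_hd_le (x : Data) : x.hd.size ≤ x.size := by
  cases x <;> simp [Data.size, Data.hd]; omega

theorem Data.size_tl_le (x : Data) : x.tl.size ≤ x.size := by
  cases x <;> simp [Data.size, Data.tl]

theorem Data.ofList_toList (x : Data) : Data.ofList x.toList = x := by
  induction x with
  | nil => rfl
  | node a b _ ih => simp [Data.toList, Data.ofList, ih]

theorem Data.toList_ofList (l : List Data) : (Data.ofList l).toList = l := by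
  induction l with
  | nil => rfl
  | cons a l ih => simp [Data.toList, Data.ofList, ih]

theorem Data.size_ofList (l : List Data) :
    (Data.ofList l).size = 1 + (l.map fun a => 1 + a.size).sum := by
  induction l with
  | nil => rfl
  | cons a l ih => simp [Data.size, Data.ofList, ih]; ring

theorem Data.length_le_size (x : Data) : x.toList.length ≤ x.size := by
  induction x with
  | nil => simp [Data.toList]
  | node a b _ ih => simp [Data.toList, Data.size]; omega

theorem Data.size_ofList_append (l k : List Data) :
    (Data.ofList (l ++ k)).size + 1 = (Data.ofList l).size + (Data.ofList k).size := by
  simp only [Data.size_ofList, List.map_append, List.sum_append]; ring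

theorem Data.size_ofList_take_le (l : List Data) (k : ℕ) :
    (Data.ofList (l.take k)).size ≤ (Data.ofList l).size := by
  have h := Data.size_ofList_append (l.take k) (l.drop k)
  rw [List.take_append_drop] at h
  have := (Data.ofList (l.drop k)).one_le_size
  omega

theorem Data.size_ofList_drop_le (l : List Data) (k : ℕ) :
    (Data.ofList (l.drop k)).size ≤ (Data.ofList l).size := by
  have h := Data.size_ofList_append (l.take k) (l.drop k)
  rw [List.take_append_drop] at h
  have := (Data.ofList (l.take k)).one_le_size
  omega

theorem Data.size_ofList_reverse (l : List Data) :
    (Data.ofList l.reverse).size = (Data.ofList l).size := by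
  simp [Data.size_ofList, List.sum_reverse]

theorem Data.size_ofList_filter_le (p : Data → Bool) (l : List Data) :
    (Data.ofList (l.filter p)).size ≤ (Data.ofList l).size := by
  induction l with
  | nil => simp
  | cons a l ih =>
    rw [List.filter_cons]
    split <;> simp only [Data.ofList, Data.size] <;> omega

/-- The output of a computation is no larger than its cost. -/
theorem Prog.Runs.size_le {p : Prog} {x y : Data} {t : ℕ} (h : p.Runs x y t) : y.size ≤ t := by
  induction h with
  | id x => exact le_rfl
  | nil x => exact x.one_le_size
  | hd x => exact x.size_hd_le
  | tl x => exact x.size_tl_le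
  | eq x =>
    have := x.one_le_size
    split <;> simp [Data.size]; omega
  | pair _ _ h1 h2 => simp only [Data.size]; omega
  | comp _ _ h1 h2 => omega
  | iteTrue _ _ _ h1 h2 => omega
  | iteFalse _ _ _ h1 h2 => omega
  | loopDone _ => exact le_rfl
  | loopStep _ _ _ h1 h2 => omega

theorem monotone_natPolynomial_eval (q : Polynomial ℕ) : Monotone fun n => q.eval n := by
  intro a b h
  simp only [Polynomial.eval_eq_sum_range]
  gcongr

namespace IsPolyTime

theorem of_runs {f : Data → Data} {p : Prog} (q : Polynomial ℕ)
    (h : ∀ x : Data, p.Runs x (f x) (q.eval x.size)) : IsPolyTime f :=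
  ⟨p, q, fun x => ⟨_, le_rfl, h x⟩⟩

theorem id : IsPolyTime fun x => x :=
  of_runs Polynomial.X fun x => by simpa using Prog.Runs.id x

theorem size_le {f : Data → Data} (hf : IsPolyTime f) :
    ∃ q : Polynomial ℕ, ∀ x, (f x).size ≤ q.eval x.size := by
  obtain ⟨p, q, h⟩ := hf
  refine ⟨q, fun x => ?_⟩
  obtain ⟨t, ht, hr⟩ := h x
  exact hr.size_le.trans ht

theorem comp {f g : Data → Data} (hg : IsPolyTime g) (hf : IsPolyTime f) :
    IsPolyTime fun x => g (f x) := by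
  obtain ⟨p, q, h⟩ := hf
  obtain ⟨p', q', h'⟩ := hg
  refine ⟨.comp p' p, q + q'.comp q + 1, fun x => ?_⟩
  obtain ⟨s, hs, hr⟩ := h x
  obtain ⟨t, ht, hr'⟩ := h' (f x)
  refine ⟨s + t + 1, ?_, .comp hr hr'⟩
  -- The second program runs on an input no larger than the cost of the first.
  have := monotone_natPolynomial_eval q' (hr.size_le.trans hs)
  simp only [Polynomial.eval_add, Polynomial.eval_comp, Polynomial.eval_one] at *
  omega

theorem node {f g : Data → Data} (hf : IsPolyTime f) (hg : IsPolyTime g) :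
    IsPolyTime fun x => .node (f x) (g x) := by
  obtain ⟨p, q, h⟩ := hf
  obtain ⟨p', q', h'⟩ := hg
  refine ⟨.pair p p', q + q' + 1, fun x => ?_⟩
  obtain ⟨s, hs, hr⟩ := h x
  obtain ⟨t, ht, hr'⟩ := h' x
  refine ⟨s + t + 1, ?_, .pair hr hr'⟩
  simp only [Polynomial.eval_add, Polynomial.eval_one]
  omega

theorem hd {f : Data → Data} (hf : IsPolyTime f) : IsPolyTime fun x => (f x).hd :=
  comp (of_runs (p := .hd) Polynomial.X fun x => by simpa using Prog.Runs.hd x) hf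

theorem tl {f : Data → Data} (hf : IsPolyTime f) : IsPolyTime fun x => (f x).tl :=
  comp (of_runs (p := .tl) Polynomial.X fun x => by simpa using Prog.Runs.tl x) hf

theorem const (a : Data) : IsPolyTime fun _ => a := by
  induction a with
  | nil => exact of_runs (p := .nil) Polynomial.X fun x => by simpa using Prog.Runs.nil x
  | node a b ha hb => exact ha.node hb

theorem ite_eq {f g : Data → Data} (hf : IsPolyTime f) (hg : IsPolyTime g) :
    IsPolyTime fun x => if f x = g x then .node .nil .nil else .nil :=
  comp (f := fun x => .node (f x) (g x))
    (g := fun x => if x.hd = x.tl then .node .nil .nil else .nil)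
    (of_runs (p := .eq) (Polynomial.X + 2) fun x => by simpa using Prog.Runs.eq x) (hf.node hg)

theorem ite_nil {c f g : Data → Data} (hc : IsPolyTime c) (hf : IsPolyTime f)
    (hg : IsPolyTime g) : IsPolyTime fun x => if c x = .nil then g x else f x := by
  obtain ⟨p, q, h⟩ := hf
  obtain ⟨p', q', h'⟩ := hg
  obtain ⟨p'', q'', h''⟩ := hc
  refine ⟨.ite p'' p p', q'' + (q + q') + 1, fun x => ?_⟩
  obtain ⟨s, hs, hr⟩ := h x
  obtain ⟨t, ht, hr'⟩ := h' x
  obtain ⟨u, hu, hr''⟩ := h'' x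
  simp only [Polynomial.eval_add, Polynomial.eval_one]
  by_cases hx : c x = .nil
  · rw [if_pos hx]
    exact ⟨u + t + 1, by omega, .iteFalse hr'' hx hr'⟩
  · rw [if_neg hx]
    exact ⟨u + s + 1, by omega, .iteTrue hr'' hx hr⟩

end IsPolyTime

/-- One round of a fold: the state consists of the rest of the list, a context, and the
accumulated value. -/
def foldBody (step : Data → Data → Data → Data) (x : Data) : Data :=
  .node x.hd.tl (.node x.tl.hd (step x.tl.hd x.tl.tl x.hd.hd))

/-- `K` bounds the unread list and `M` every intermediate accumulator, so the state always has size
at most `2 + K + ctx.size + M`, the `2` being its two pairing nodes. The bound on all prefixes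
`l.take k` is what survives the passage to the tail; the extra round in `l.length + 1` is the final
test. -/
theorem runs_loop_foldBody {step : Data → Data → Data → Data} {p : Prog} {q : Polynomial ℕ}
    (hp : ∀ x : Data, ∃ t, t ≤ q.eval x.size ∧ p.Runs x (foldBody step x) t)
    (ctx : Data) (K M : ℕ) (l : List Data) :
    ∀ acc : Data, (Data.ofList l).size ≤ K →
      (∀ k, ((l.take k).foldl (step ctx) acc).size ≤ M) →
      ∃ t, t ≤ (l.length + 1) * (2 + K + ctx.size + M + q.eval (2 + K + ctx.size + M)) ∧
        (Prog.loop p).Runs (.node (.ofList l) (.node ctx acc))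
          (.node .nil (.node ctx (l.foldl (step ctx) acc))) t := by
  induction l with
  | nil =>
    intro acc hK hM
    have hM0 := hM 0
    refine ⟨_, ?_, .loopDone rfl⟩
    simp [Data.size, Data.ofList] at *
    omega
  | cons a l ih =>
    intro acc hK hM
    have hM0 : acc.size ≤ M := by simpa using hM 0
    have hl : (Data.ofList l).size ≤ K := by
      simp only [Data.ofList, Data.size] at hK; omega
    obtain ⟨t, ht, hr⟩ := ih (step ctx acc a) hl fun k => by simpa using hM (k + 1)
    by_cases ha : Data.ofList (a :: l) = .nil
    · simp [Data.ofList] at ha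
    obtain ⟨s, hs, hr'⟩ := hp (.node (.ofList (a :: l)) (.node ctx acc))
    refine ⟨_, ?_, .loopStep (by simpa [Data.hd] using ha) hr' hr⟩
    have hsz : (Data.node (.ofList (a :: l)) (.node ctx acc)).size ≤ 2 + K + ctx.size + M := by
      simp only [Data.size] at *; omega
    have := monotone_natPolynomial_eval q hsz
    simp only [List.length_cons] at *
    rw [add_mul (l.length + 1), one_mul]
    omega

/-- A fold over a list runs in polynomial time if each step does and the accumulated value stays
polynomially bounded. -/
theorem IsPolyTime.foldl {step : Data → Data → Data → Data}
    (hstep : IsPolyTime fun x => step x.hd x.tl.hd x.tl.tl) (b : Polynomial ℕ)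
    (hb : ∀ (ctx acc : Data) (l : List Data),
      (l.foldl (step ctx) acc).size ≤ b.eval (ctx.size + acc.size + (Data.ofList l).size)) :
    IsPolyTime fun x => x.tl.tl.toList.foldl (step x.hd) x.tl.hd := by
  have hbody : IsPolyTime (foldBody step) :=
    .node (IsPolyTime.id.hd.tl) (.node IsPolyTime.id.tl.hd
      (hstep.comp (.node IsPolyTime.id.tl.hd (.node IsPolyTime.id.tl.tl IsPolyTime.id.hd.hd))))
  obtain ⟨p, q, hp⟩ := hbody
  -- `r` bounds the size of the loop state. Context, start value and list are each at most `x.size`,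
  -- whence the `3` inside `b`.
  let r : Polynomial ℕ := 2 + 2 * Polynomial.X + b.comp (3 * Polynomial.X)
  -- The loop is analysed only on states of this shape, so it is composed with the initial
  -- rearrangement through `Prog.Runs`, not through `IsPolyTime.comp`.
  have hloop : ∃ (p' : Prog) (q' : Polynomial ℕ), ∀ x : Data, ∃ t, t ≤ q'.eval x.size ∧
      p'.Runs (.node x.tl.tl (.node x.hd x.tl.hd))
        (.node .nil (.node x.hd (x.tl.tl.toList.foldl (step x.hd) x.tl.hd))) t := by
    refine ⟨.loop p, (Polynomial.X + 1) * (r + q.comp r), fun x => ?_⟩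
    have h1 := x.size_hd_le
    have h2 := x.size_tl_le
    have h3 := x.tl.size_hd_le
    have h4 := x.tl.size_tl_le
    obtain ⟨t, ht, hr⟩ := runs_loop_foldBody hp x.hd x.size (b.eval (3 * x.size)) x.tl.tl.toList
      x.tl.hd (by rw [Data.ofList_toList]; omega) fun k => by
        refine (hb _ _ _).trans (monotone_natPolynomial_eval b ?_)
        have := Data.size_ofList_take_le x.tl.tl.toList k
        rw [Data.ofList_toList] at this
        omega
    rw [Data.ofList_toList] at hr
    refine ⟨t, ht.trans ?_, hr⟩
    have h5 := x.tl.tl.length_le_size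
    have hr' : 2 + x.size + x.hd.size + b.eval (3 * x.size) ≤ r.eval x.size := by
      simp [r, Polynomial.eval_comp]; omega
    have := monotone_natPolynomial_eval q hr'
    simp only [Polynomial.eval_mul, Polynomial.eval_add, Polynomial.eval_X, Polynomial.eval_one,
      Polynomial.eval_comp] at *
    gcongr
    omega
  obtain ⟨p', q', h'⟩ := hloop
  have hinit : IsPolyTime fun x => .node x.tl.tl (.node x.hd x.tl.hd) :=
    .node IsPolyTime.id.tl.tl (.node IsPolyTime.id.hd IsPolyTime.id.tl.hd)
  obtain ⟨pi, qi, hi⟩ := hinit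
  have hmid : IsPolyTime fun x =>
      .node .nil (.node x.hd (x.tl.tl.toList.foldl (step x.hd) x.tl.hd)) := by
    refine ⟨.comp p' pi, qi + q' + 1, fun x => ?_⟩
    obtain ⟨s, hs, hr⟩ := hi x
    obtain ⟨t, ht, hr'⟩ := h' x
    refine ⟨_, ?_, .comp hr hr'⟩
    simp only [Polynomial.eval_add, Polynomial.eval_one]
    omega
  exact hmid.tl.tl

namespace IsPolyTime

/-- Pushing entries one by one onto an accumulator reverses them; reversal and concatenation follow
from this one fold. -/
theorem reverse_append {f g : Data → Data} (hf : IsPolyTime f) (hg : IsPolyTime g) :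
    IsPolyTime fun x => .ofList ((f x).toList.reverse ++ (g x).toList) := by
  have key : ∀ (l : List Data) (a : Data),
      l.foldl (fun acc e => Data.node e acc) a = .ofList (l.reverse ++ a.toList) := by
    intro l
    induction l with
    | nil => intro a; simp [Data.ofList_toList]
    | cons e l ih => intro a; simp [ih, Data.toList]
  have h := IsPolyTime.foldl (step := fun _ acc e => .node e acc)
    (.node IsPolyTime.id.tl.tl IsPolyTime.id.tl.hd) Polynomial.X fun ctx acc l => by
      rw [key]
      have := Data.size_ofList_append l.reverse acc.toList
      rw [Data.ofList_toList, Data.size_ofList_reverse] at this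
      simp; omega
  have h' := h.comp (.node (const .nil) (.node hg hf))
  simpa only [key, Data.tl_node, Data.hd_node] using h'

theorem reverse {f : Data → Data} (hf : IsPolyTime f) :
    IsPolyTime fun x => .ofList (f x).toList.reverse := by
  simpa only [Data.toList, List.append_nil] using hf.reverse_append (const .nil)

theorem append {f g : Data → Data} (hf : IsPolyTime f) (hg : IsPolyTime g) :
    IsPolyTime fun x => .ofList ((f x).toList ++ (g x).toList) := by
  simpa only [Data.toList_ofList, List.reverse_reverse] using hf.reverse.reverse_append hg

/-- Filtering a list by a polynomial-time predicate with a context. -/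
theorem filter {c : Data → Data} {p : Data → Data → Bool}
    (hp : IsPolyTime fun x => if p x.hd x.tl then .node .nil .nil else .nil)
    {f : Data → Data} (hc : IsPolyTime c) (hf : IsPolyTime f) :
    IsPolyTime fun x => .ofList ((f x).toList.filter (p (c x))) := by
  let step : Data → Data → Data → Data := fun ctx acc e => if p ctx e then .node e acc else acc
  have key : ∀ (ctx : Data) (l : List Data) (a : Data),
      l.foldl (step ctx) a = .ofList ((l.filter (p ctx)).reverse ++ a.toList) := by
    intro ctx l
    induction l with
    | nil => intro a; simp [Data.ofList_toList]
    | cons e l ih =>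
      intro a
      by_cases he : p ctx e <;> simp [ih, he, Data.toList, step]
  have hstep : IsPolyTime fun x => step x.hd x.tl.hd x.tl.tl := by
    have := ite_nil (hp.comp (.node IsPolyTime.id.hd IsPolyTime.id.tl.tl))
      (.node IsPolyTime.id.tl.tl IsPolyTime.id.tl.hd) IsPolyTime.id.tl.hd
    convert this using 2 with x
    by_cases hx : p x.hd x.tl.tl <;> simp [step, hx]
  have h := IsPolyTime.foldl hstep Polynomial.X fun ctx acc l => by
      rw [key]
      have := Data.size_ofList_append (l.filter (p ctx)).reverse acc.toList
      have h2 := Data.size_ofList_filter_le (p ctx) l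
      rw [Data.ofList_toList, Data.size_ofList_reverse] at this
      simp; omega
  -- The fold collects the retained entries in reverse order.
  have h' := (h.comp (.node hc (.node (const .nil) hf))).reverse
  simpa only [key, Data.tl, Data.hd, Data.toList_ofList, Data.toList, List.append_nil,
    List.reverse_reverse] using h'

/-- The list `f x` serves as a unary counter: each of its entries triggers one `tl`. -/
theorem drop {f g : Data → Data} (hf : IsPolyTime f) (hg : IsPolyTime g) :
    IsPolyTime fun x => .ofList ((g x).toList.drop (f x).toList.length) := by
  have htl : ∀ a : Data, a.tl.toList = a.toList.tail := fun a => by cases a <;> rfl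
  have key : ∀ (l : List Data) (a : Data),
      l.foldl (fun acc _ => Data.tl acc) a = .ofList (a.toList.drop l.length) := by
    intro l
    induction l with
    | nil => intro a; simp [Data.ofList_toList]
    | cons e l ih => intro a; simp [ih, htl]
  have h := IsPolyTime.foldl (step := fun _ acc _ => acc.tl)
    IsPolyTime.id.tl.hd.tl Polynomial.X fun ctx acc l => by
      rw [key]
      have := Data.size_ofList_drop_le acc.toList l.length
      rw [Data.ofList_toList] at this
      simp; omega
  have h' := h.comp (.node (const .nil) (.node hg hf))
  simpa only [key, Data.tl_node, Data.hd_node] using h'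

/-- A prefix is obtained by removing, from the reversed list, as many entries as the complementary
suffix has, and reversing back. -/
theorem take {f g : Data → Data} (hf : IsPolyTime f) (hg : IsPolyTime g) :
    IsPolyTime fun x => .ofList ((g x).toList.take (f x).toList.length) := by
  have h := (hf.drop hg).reverse.drop hg.reverse
  have h' := h.reverse
  convert h' using 3 with x
  simp only [Data.toList_ofList, List.length_reverse, List.length_drop, List.drop_reverse,
    List.reverse_reverse]
  rcases Nat.le_total (f x).toList.length (g x).toList.length with hl | hl
  · congr 1; omega
  · rw [List.take_of_length_le hl, List.take_of_length_le (by omega)]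

end IsPolyTime

/-- Predicates on trees that are decidable in polynomial time. -/
def IsPolyTimePred (p : Data → Bool) : Prop :=
  IsPolyTime fun x => if p x then .node .nil .nil else .nil

namespace IsPolyTimePred

theorem const (b : Bool) : IsPolyTimePred fun _ => b :=
  IsPolyTime.const _

theorem comp {p : Data → Bool} {f : Data → Data} (hp : IsPolyTimePred p) (hf : IsPolyTime f) :
    IsPolyTimePred fun x => p (f x) :=
  IsPolyTime.comp hp hf

theorem not {p : Data → Bool} (hp : IsPolyTimePred p) : IsPolyTimePred fun x => !p x := by
  have := IsPolyTime.ite_nil hp (.const .nil) (.const (.node .nil .nil))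
  refine Eq.mp (congrArg IsPolyTime (funext fun x => ?_)) this
  cases hx : p x <;> simp [hx]

theorem and {p q : Data → Bool} (hp : IsPolyTimePred p) (hq : IsPolyTimePred q) :
    IsPolyTimePred fun x => p x && q x := by
  have := IsPolyTime.ite_nil hp hq (.const .nil)
  refine Eq.mp (congrArg IsPolyTime (funext fun x => ?_)) this
  cases hx : p x <;> simp [hx]

theorem all {α : Type} {p : α → Data → Bool} (l : List α) (hp : ∀ a, IsPolyTimePred (p a)) :
    IsPolyTimePred fun x => l.all fun a => p a x := by
  induction l with
  | nil => exact const true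
  | cons a l ih => simpa only [List.all_cons] using (hp a).and ih

/-- Membership is nonemptiness of the list filtered by equality. -/
theorem mem {f g : Data → Data} (hf : IsPolyTime f) (hg : IsPolyTime g) :
    IsPolyTimePred fun x => decide (f x ∈ (g x).toList) := by
  have h := IsPolyTime.filter (p := fun c e => decide (c = e))
    (by simpa using IsPolyTime.ite_eq IsPolyTime.id.hd IsPolyTime.id.tl) hf hg
  have := IsPolyTime.ite_nil h (.const (.node .nil .nil)) (.const .nil)
  refine Eq.mp (congrArg IsPolyTime (funext fun x => ?_)) this
  by_cases hx : f x ∈ (g x).toList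
  · have : (g x).toList.filter (fun e => decide (f x = e)) ≠ [] :=
      List.ne_nil_of_mem (List.mem_filter.2 ⟨hx, by simp⟩)
    obtain ⟨a, l, hl⟩ := List.exists_cons_of_ne_nil this
    simp [hx, hl, Data.ofList]
  · have : (g x).toList.filter (fun e => decide (f x = e)) = [] := by
      rw [List.filter_eq_nil_iff]
      intro e he h
      exact hx (by simpa [of_decide_eq_true h] using he)
    simp [hx, this, Data.ofList]

end IsPolyTimePred

/-! ### Encodings: injectivity, sizes, and subsets as filtered lists -/

theorem enc_prod {α β : Type} [Encode α] [Encode β] (a : α) (b : β) :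
    enc (a, b) = .node (enc a) (enc b) := rfl

theorem enc_data (x : Data) : enc x = x := rfl

theorem enc_list {α : Type} [Encode α] (l : List α) : enc l = .ofList (l.map enc) := rfl

theorem enc_bool_injective : Function.Injective (enc : Bool → Data) := by
  intro a b h
  cases a <;> cases b <;> first | rfl | exact absurd h (by simp [enc])

theorem ofList_injective : Function.Injective Data.ofList := fun a b h => by
  rw [← Data.toList_ofList a, h, Data.toList_ofList]

theorem enc_list_injective {α : Type} [Encode α] (h : Function.Injective (enc : α → Data)) :
    Function.Injective (enc : List α → Data) :=
  ofList_injective.comp (List.map_injective_iff.2 h)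

theorem enc_elem_injective : Function.Injective (enc : Elem → Data) :=
  enc_list_injective enc_bool_injective

theorem enc_nat_toList (n : ℕ) : (enc n).toList = List.replicate n .nil :=
  Data.toList_ofList _

theorem enc_nat_injective : Function.Injective (enc : ℕ → Data) := by
  intro a b h
  simpa [enc_nat_toList] using congrArg (fun x => x.toList.length) h

theorem enc_fin_injective {n : ℕ} : Function.Injective (enc : Fin n → Data) :=
  fun _ _ h => Fin.ext (enc_nat_injective h)

theorem enc_triple_injective {m : ℕ} : Function.Injective (enc : Triple m → Data) := by
  rintro a b h
  obtain ⟨h1, h2⟩ := Data.node.inj h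
  obtain ⟨h3, h4⟩ := Data.node.inj h2
  have := enc_elem_injective h1
  have := enc_fin_injective h3
  have := enc_fin_injective h4
  apply ofLex.injective
  apply Prod.ext
  · assumption
  · apply ofLex.injective
    apply Prod.ext <;> assumption

theorem size_enc_nat (n : ℕ) : (enc n).size = 1 + 2 * n := by
  rw [show enc n = Data.ofList (List.replicate n .nil) from rfl, Data.size_ofList]
  simp [Data.size]; ring

theorem enc_nat_add (a b : ℕ) : enc (a + b) = .ofList ((enc a).toList ++ (enc b).toList) := by
  rw [enc_nat_toList, enc_nat_toList, ← List.replicate_add]; rfl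

theorem size_enc_pi {α : Type} [Encode α] {n : ℕ} (v : Fin n → α) :
    (enc v).size = 1 + ∑ i, (1 + (enc (v i)).size) := by
  rw [show enc v = Data.ofList ((List.ofFn v).map enc) from rfl, Data.size_ofList, List.map_map,
    List.map_ofFn, List.sum_ofFn]
  rfl

theorem size_enc_le_pi {α : Type} [Encode α] {n : ℕ} (v : Fin n → α) (i : Fin n) :
    (enc (v i)).size ≤ (enc v).size := by
  rw [size_enc_pi]
  have := Finset.single_le_sum (f := fun i => 1 + (enc (v i)).size) (fun _ _ => Nat.zero_le _)
    (Finset.mem_univ i)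
  omega

theorem size_enc_pi_le {α : Type} [Encode α] {n : ℕ} (v : Fin n → α) (M : ℕ)
    (h : ∀ i, (enc (v i)).size ≤ M) : (enc v).size ≤ 1 + n * (1 + M) := by
  rw [size_enc_pi]
  have := Finset.sum_le_card_nsmul Finset.univ (fun i => 1 + (enc (v i)).size) (1 + M)
    fun i _ => by have := h i; omega
  simpa using this

theorem sort_filter {α : Type} [LinearOrder α] (s : Finset α) (p : α → Prop) [DecidablePred p] :
    (s.filter p).sort = s.sort.filter p := by
  -- Both sides are sorted lists with the same underlying multiset.
  refine List.Perm.eq_of_pairwise (le := (· ≤ ·)) (fun a b _ _ => le_antisymm)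
    ((s.filter p).pairwise_sort _) ((s.pairwise_sort (· ≤ ·)).filter _) ?_
  rw [← Multiset.coe_eq_coe, ← Multiset.filter_coe, Finset.sort_eq, Finset.sort_eq]
  rfl

section Finset

variable {α : Type} [Encode α] [LinearOrder α]

theorem toList_enc_finset (s : Finset α) : (enc s).toList = s.sort.map enc :=
  Data.toList_ofList _

theorem mem_toList_enc_finset (h : Function.Injective (enc : α → Data)) (s : Finset α) (a : α) :
    enc a ∈ (enc s).toList ↔ a ∈ s := by
  rw [toList_enc_finset, List.mem_map_of_injective h, Finset.mem_sort]

theorem size_enc_finset (s : Finset α) : (enc s).size = 1 + ∑ a ∈ s, (1 + (enc a).size) := by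
  rw [show enc s = Data.ofList (s.sort.map enc) from rfl, Data.size_ofList, List.map_map]
  congr 1
  have h : (s.sort : Multiset α) = s.val := s.sort_eq (· ≤ ·)
  rw [Finset.sum, ← h, Multiset.map_coe, Multiset.sum_coe]
  rfl

theorem size_enc_finset_mono {s t : Finset α} (h : s ⊆ t) : (enc s).size ≤ (enc t).size := by
  rw [size_enc_finset, size_enc_finset]
  exact Nat.add_le_add_left (Finset.sum_le_sum_of_subset h) _

/-- Sorting commutes with filtering, so a program obtains the code of a subset by filtering the code
of the set; only the behaviour of `q` on codes of elements of `s` matters. -/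
theorem enc_finset_filter (s : Finset α) (p : α → Prop) [DecidablePred p] (q : Data → Bool)
    (h : ∀ a ∈ s, q (enc a) = decide (p a)) :
    enc (s.filter p) = .ofList ((enc s).toList.filter q) := by
  rw [show enc (s.filter p) = Data.ofList ((s.filter p).sort.map enc) from rfl, sort_filter,
    toList_enc_finset, List.filter_map]
  congr 2
  refine List.filter_congr fun a ha => ?_
  simp [h a ((Finset.mem_sort _).1 ha)]

end Finset

/-! ## Expectations and statistical closeness -/

section Expect

variable {α β : Type}

/-- Expectation of a nonnegative function. -/
noncomputable def expect (X : PMF α) (f : α → ℝ≥0∞) : ℝ≥0∞ := ∑' a, X a * f a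

theorem expect_pure (a : α) (f : α → ℝ≥0∞) : expect (PMF.pure a) f = f a := by
  rw [expect, tsum_eq_single a] <;> simp +contextual [PMF.pure_apply]

theorem expect_bind (X : PMF α) (g : α → PMF β) (f : β → ℝ≥0∞) :
    expect (X.bind g) f = expect X fun a => expect (g a) f := by
  simp only [expect, PMF.bind_apply, ← ENNReal.tsum_mul_right, ← ENNReal.tsum_mul_left]
  rw [ENNReal.tsum_comm]
  simp only [mul_assoc]

theorem expect_map (X : PMF α) (g : α → β) (f : β → ℝ≥0∞) :
    expect (X.map g) f = expect X fun a => f (g a) := by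
  rw [← PMF.bind_pure_comp, expect_bind]
  simp [expect_pure]

theorem expect_mono (X : PMF α) {f g : α → ℝ≥0∞} (h : ∀ a ∈ X.support, f a ≤ g a) :
    expect X f ≤ expect X g := by
  refine ENNReal.tsum_le_tsum fun a => ?_
  by_cases ha : a ∈ X.support
  · gcongr; exact h a ha
  · simp [(X.apply_eq_zero_iff a).2 ha]

theorem expect_add (X : PMF α) (f g : α → ℝ≥0∞) :
    (expect X fun a => f a + g a) = expect X f + expect X g := by
  simp only [expect, mul_add, ENNReal.tsum_add]

theorem expect_const (X : PMF α) (c : ℝ≥0∞) : (expect X fun _ => c) = c := by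
  simp [expect, ENNReal.tsum_mul_right]

theorem toOuterMeasure_eq_expect (X : PMF α) (E : Set α) :
    X.toOuterMeasure E = expect X (E.indicator 1) := by
  rw [PMF.toOuterMeasure_apply, expect]
  refine tsum_congr fun a => ?_
  by_cases h : a ∈ E <;> simp [h]

theorem toOuterMeasure_le_one (X : PMF α) (E : Set α) : X.toOuterMeasure E ≤ 1 := by
  rw [toOuterMeasure_eq_expect, ← expect_const X 1]
  exact expect_mono X fun a _ => Set.indicator_le_self _ _ _

theorem toOuterMeasure_ne_top (X : PMF α) (E : Set α) : X.toOuterMeasure E ≠ ∞ :=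
  ((toOuterMeasure_le_one X E).trans_lt ENNReal.one_lt_top).ne

theorem prob_nonneg (X : PMF α) (E : Set α) : 0 ≤ prob X E := ENNReal.toReal_nonneg

/-- No test tells the two distributions apart with advantage more than `ε`. -/
def StatClose (X Y : PMF α) (ε : ℝ≥0∞) : Prop :=
  ∀ f : α → ℝ≥0∞, (∀ a, f a ≤ 1) → expect X f ≤ expect Y f + ε ∧ expect Y f ≤ expect X f + ε

namespace StatClose

variable {X Y : PMF α} {ε δ : ℝ≥0∞}

theorem refl (X : PMF α) : StatClose X X 0 := fun f _ => by simp

/-- The expected value of a test under the second kernel is again a test with values in `[0, 1]`;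
this is why closeness is formulated with functions instead of events. The two errors add up. -/
theorem bind {g h : α → PMF β} (hXY : StatClose X Y ε) (hgh : ∀ a, StatClose (g a) (h a) δ) :
    StatClose (X.bind g) (Y.bind h) (ε + δ) := by
  have le_one : ∀ (Z : PMF β) (f : β → ℝ≥0∞), (∀ a, f a ≤ 1) → expect Z f ≤ 1 := fun Z f hf => by
    rw [← expect_const Z 1]; exact expect_mono Z fun a _ => hf a
  intro f hf
  rw [expect_bind, expect_bind]
  constructor
  · refine (expect_mono X fun a _ => ((hgh a) f hf).1).trans ?_
    rw [expect_add, expect_const, ← add_assoc]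
    gcongr
    exact (hXY _ fun a => le_one (h a) f hf).1
  · refine (hXY _ fun a => le_one (h a) f hf).2.trans ?_
    rw [add_comm ε, ← add_assoc]
    gcongr
    refine (expect_mono X fun a _ => ((hgh a) f hf).2).trans ?_
    rw [expect_add, expect_const]

theorem map (hXY : StatClose X Y ε) (g : α → β) : StatClose (X.map g) (Y.map g) ε := by
  intro f hf
  rw [expect_map, expect_map]
  exact hXY _ fun a => hf _

/-- Functions that agree outside of `B` have close distributions. -/
theorem of_eq_on_compl (X : PMF α) (g h : α → β) (B : Set α) (hgh : ∀ a, a ∉ B → g a = h a) :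
    StatClose (X.map g) (X.map h) (X.toOuterMeasure B) := by
  have key : ∀ (g h : α → β), (∀ a, a ∉ B → g a = h a) → ∀ f : β → ℝ≥0∞, (∀ a, f a ≤ 1) →
      expect (X.map g) f ≤ expect (X.map h) f + X.toOuterMeasure B := by
    intro g h hgh f hf
    rw [expect_map, expect_map, toOuterMeasure_eq_expect, ← expect_add]
    refine expect_mono X fun a _ => ?_
    by_cases ha : a ∈ B
    · simpa [ha] using (hf (g a)).trans le_add_self
    · simp [ha, hgh a ha]
  exact fun f hf => ⟨key g h hgh f hf, key h g (fun a ha => (hgh a ha).symm) f hf⟩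

theorem abs_prob_sub_le (hXY : StatClose X Y ε) (hε : ε ≠ ∞) (E : Set α) :
    |prob X E - prob Y E| ≤ ε.toReal := by
  obtain ⟨h1, h2⟩ := hXY (E.indicator 1) fun a => Set.indicator_le_self _ _ _
  rw [← toOuterMeasure_eq_expect, ← toOuterMeasure_eq_expect] at h1 h2
  have hX := toOuterMeasure_ne_top X E
  have hY := toOuterMeasure_ne_top Y E
  have h1' := ENNReal.toReal_mono (by simp [hY, hε]) h1
  have h2' := ENNReal.toReal_mono (by simp [hX, hε]) h2
  rw [ENNReal.toReal_add hY hε] at h1'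
  rw [ENNReal.toReal_add hX hε] at h2'
  rw [abs_sub_le_iff]
  unfold prob
  constructor <;> linarith

end StatClose

/-- Averaging: if the two kernels differ by at most `ε` on the event for each sample, then so do the
mixtures. -/
theorem abs_prob_bind_sub_le (Z : PMF α) (g h : α → PMF β) (E : Set β) {ε : ℝ}
    (hgh : ∀ z ∈ Z.support, |prob (g z) E - prob (h z) E| ≤ ε) :
    |prob (Z.bind g) E - prob (Z.bind h) E| ≤ ε := by
  have hε : 0 ≤ ε := by
    obtain ⟨z, hz⟩ := Z.support_nonempty
    exact (abs_nonneg _).trans (hgh z hz)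
  have key : ∀ g h : α → PMF β, (∀ z ∈ Z.support, |prob (g z) E - prob (h z) E| ≤ ε) →
      prob (Z.bind g) E ≤ prob (Z.bind h) E + ε := by
    intro g h hgh
    have h1 : (Z.bind g).toOuterMeasure E ≤ (Z.bind h).toOuterMeasure E + ENNReal.ofReal ε := by
      simp only [toOuterMeasure_eq_expect (Z.bind _), expect_bind]
      rw [← expect_const Z (ENNReal.ofReal ε), ← expect_add]
      refine expect_mono Z fun z hz => ?_
      have h2 := (abs_sub_le_iff.1 (hgh z hz)).1
      simp only [← toOuterMeasure_eq_expect]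
      rw [← ENNReal.ofReal_toReal (toOuterMeasure_ne_top (g z) E),
        ← ENNReal.ofReal_toReal (toOuterMeasure_ne_top (h z) E),
        ← ENNReal.ofReal_add ENNReal.toReal_nonneg hε]
      refine ENNReal.ofReal_le_ofReal ?_
      unfold prob at h2
      linarith
    have h3 := ENNReal.toReal_mono (ENNReal.add_ne_top.2
      ⟨toOuterMeasure_ne_top _ _, ENNReal.ofReal_ne_top⟩) h1
    rwa [ENNReal.toReal_add (toOuterMeasure_ne_top _ _) ENNReal.ofReal_ne_top,
      ENNReal.toReal_ofReal hε] at h3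
  rw [abs_sub_le_iff]
  have h1 := key g h hgh
  have h2 := key h g fun z hz => by rw [abs_sub_comm]; exact hgh z hz
  constructor <;> linarith

/-- Some sample attains at least half of the difference of the mixtures. -/
theorem exists_abs_prob_bind_sub_le (Z : PMF α) (g h : α → PMF β) (E : Set β) :
    ∃ z ∈ Z.support, |prob (Z.bind g) E - prob (Z.bind h) E| ≤
      2 * |prob (g z) E - prob (h z) E| := by
  -- A supremum over an infinite support need not be attained, but half of a positive one is
  -- exceeded; otherwise averaging would bound the difference by half of itself.
  by_contra! hc
  have h1 := abs_prob_bind_sub_le Z g h E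
    (ε := |prob (Z.bind g) E - prob (Z.bind h) E| / 2) fun z hz => by
      have := hc z hz; linarith
  obtain ⟨z, hz⟩ := Z.support_nonempty
  have h2 := hc z hz
  have h3 := abs_nonneg (prob (g z) E - prob (h z) E)
  linarith

end Expect

/-! ## Uniform distributions -/

section Uniform

theorem uniformOfFintype_map_equiv {α β : Type} [Fintype α] [Nonempty α] [Fintype β] [Nonempty β]
    (e : α ≃ β) : (PMF.uniformOfFintype α).map e = PMF.uniformOfFintype β := by
  ext b
  rw [PMF.map_apply, tsum_eq_single (e.symm b)]
  · simp [Fintype.card_congr e]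
  · intro a ha
    rw [if_neg]
    rintro rfl
    simp at ha

theorem uniformOfFintype_prod (α β : Type) [Fintype α] [Nonempty α] [Fintype β] [Nonempty β] :
    PMF.uniformOfFintype (α × β) =
      (PMF.uniformOfFintype α).bind fun a => (PMF.uniformOfFintype β).map (Prod.mk a) := by
  ext ⟨a, b⟩
  rw [PMF.bind_apply, tsum_eq_single a]
  · rw [PMF.map_apply, tsum_eq_single b]
    · simp only [PMF.uniformOfFintype_apply, if_true, Fintype.card_prod, Nat.cast_mul]
      rw [ENNReal.mul_inv] <;> simp
    · intro b' hb'
      rw [if_neg]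
      rintro h
      exact hb' (Prod.mk.inj h).2.symm
  · intro a' ha'
    have : ((PMF.uniformOfFintype β).map (Prod.mk a')) (a, b) = 0 := by
      rw [PMF.apply_eq_zero_iff, PMF.mem_support_map_iff]
      rintro ⟨b', _, h⟩
      exact ha' (Prod.mk.inj h).1
    rw [this, mul_zero]

theorem uniformOfFintype_map_fst (α β : Type) [Fintype α] [Nonempty α] [Fintype β] [Nonempty β] :
    (PMF.uniformOfFintype (α × β)).map Prod.fst = PMF.uniformOfFintype α := by
  rw [uniformOfFintype_prod, PMF.map_bind]
  simp only [PMF.map_comp, Function.comp_def]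
  refine Eq.trans ?_ (PMF.bind_pure _)
  congr 1
  funext a
  exact PMF.map_const _ _

/-- Splitting off coordinate `i` is a bijection onto a product, whose first marginal is uniform.
This identifies one cluster within a level with a run of the protocol on its own. -/
theorem uniformOfFintype_map_eval {ι : Type} [Fintype ι] [DecidableEq ι] {A : ι → Type}
    [∀ i, Fintype (A i)] [∀ i, Nonempty (A i)] (i : ι) :
    (PMF.uniformOfFintype (∀ i, A i)).map (fun r => r i) = PMF.uniformOfFintype (A i) := by
  have h := uniformOfFintype_map_equiv (Equiv.piSplitAt i A)
  rw [← uniformOfFintype_map_fst (A i) (∀ j : { j // j ≠ i }, A j), ← h, PMF.map_comp]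
  rfl

end Uniform

/-! ## Negligible functions -/

theorem negligible_zero : Negligible fun _ => 0 := Asymptotics.superpolynomialDecay_zero _ _

theorem Negligible.add {f g : ℕ → ℝ} (hf : Negligible f) (hg : Negligible g) :
    Negligible fun n => f n + g n :=
  Asymptotics.SuperpolynomialDecay.add hf hg

theorem Negligible.const_mul {f : ℕ → ℝ} (hf : Negligible f) (c : ℝ) :
    Negligible fun n => c * f n :=
  Asymptotics.SuperpolynomialDecay.const_mul hf c

theorem Negligible.mono {f g : ℕ → ℝ} (hf : Negligible f) (h : ∀ n, |g n| ≤ f n) :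
    Negligible g :=
  Asymptotics.SuperpolynomialDecay.trans_abs_le hf fun n => (h n).trans (le_abs_self _)

theorem Negligible.sum {ι : Type} (s : Finset ι) {f : ι → ℕ → ℝ} (hf : ∀ i ∈ s, Negligible (f i)) :
    Negligible fun n => ∑ i ∈ s, f i n := by
  classical
  induction s using Finset.induction_on with
  | empty => simpa using negligible_zero
  | insert a s ha ih =>
    simp only [Finset.sum_insert ha]
    exact (hf a (Finset.mem_insert_self a s)).add
      (ih fun i hi => hf i (Finset.mem_insert_of_mem hi))

/-! ## Ensembles indexed by the security parameter -/

/-- Computational indistinguishability of two ensembles. -/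
def EnsIndist (X Y : ℕ → PMF Data) : Prop :=
  ∀ D : Distinguisher, Negligible fun n => |prob (X n) (D.accepts n) - prob (Y n) (D.accepts n)|

/-- Ensembles with samples of polynomial size. -/
def PolySized (X : ℕ → PMF Data) : Prop :=
  ∃ q : Polynomial ℕ, ∀ n, ∀ y ∈ (X n).support, y.size ≤ q.eval n

theorem PolyBounded.add {f g : ℕ → ℕ} (hf : PolyBounded f) (hg : PolyBounded g) :
    PolyBounded fun n => f n + g n := by
  obtain ⟨p, hp⟩ := hf
  obtain ⟨q, hq⟩ := hg
  exact ⟨p + q, fun n => by simpa using add_le_add (hp n) (hq n)⟩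

theorem PolyBounded.const (c : ℕ) : PolyBounded fun _ => c := ⟨Polynomial.C c, fun n => by simp⟩

theorem PolyBounded.id : PolyBounded fun n => n := ⟨Polynomial.X, fun n => by simp⟩

theorem PolyBounded.mono {f g : ℕ → ℕ} (hf : PolyBounded f) (h : ∀ n, g n ≤ f n) :
    PolyBounded g := by
  obtain ⟨p, hp⟩ := hf
  exact ⟨p, fun n => (h n).trans (hp n)⟩

theorem PolyBounded.const_mul {f : ℕ → ℕ} (hf : PolyBounded f) (c : ℕ) :
    PolyBounded fun n => c * f n := by
  obtain ⟨p, hp⟩ := hf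
  exact ⟨Polynomial.C c * p, fun n => by simpa using Nat.mul_le_mul_left c (hp n)⟩

theorem PolyBounded.poly {f : ℕ → ℕ} (hf : PolyBounded f) (q : Polynomial ℕ) :
    PolyBounded fun n => q.eval (f n) := by
  obtain ⟨p, hp⟩ := hf
  exact ⟨q.comp p, fun n => by
    simpa [Polynomial.eval_comp] using monotone_natPolynomial_eval q (hp n)⟩

namespace EnsIndist

variable {X Y Z : ℕ → PMF Data}

theorem trans (h1 : EnsIndist X Y) (h2 : EnsIndist Y Z) : EnsIndist X Z := fun D =>
  ((h1 D).add (h2 D)).mono fun n => by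
    rw [abs_abs]
    exact abs_sub_le _ _ _

theorem refl (X : ℕ → PMF Data) : EnsIndist X X := fun D => by simpa using negligible_zero

theorem of_statClose {ε : ℕ → ℝ≥0∞} (h : ∀ n, StatClose (X n) (Y n) (ε n)) (hε : ∀ n, ε n ≠ ∞)
    (hneg : Negligible fun n => (ε n).toReal) : EnsIndist X Y := fun D =>
  hneg.mono fun n => by
    rw [abs_abs]
    exact (h n).abs_prob_sub_le (hε n) _

/-- Indistinguishability is preserved by polynomial-time functions with advice. -/
theorem map_advice (h : EnsIndist X Y) (a : ℕ → Data) (ha : PolyBounded fun n => (a n).size)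
    {F : Data → Data} (hF : IsPolyTime F) :
    EnsIndist (fun n => (X n).map fun y => F (enc (n, a n, y)))
      (fun n => (Y n).map fun y => F (enc (n, a n, y))) := by
  intro D
  let D' : Distinguisher :=
    { advice := fun n => .node (D.advice n) (a n)
      run := fun x => D.run (.node x.hd (.node x.tl.hd.hd
        (F (.node x.hd (.node x.tl.hd.tl x.tl.tl)))))
      advice_polyBounded := (D.advice_polyBounded.add ha).add (.const 1) |>.mono fun n => by
        simp only [Data.size]; omega
      run_polyTime := D.run_polyTime.comp (.node IsPolyTime.id.hd (.node IsPolyTime.id.tl.hd.hd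
        (hF.comp (.node IsPolyTime.id.hd (.node IsPolyTime.id.tl.hd.tl IsPolyTime.id.tl.tl))))) }
  have key : ∀ (W : PMF Data) n,
      prob (W.map fun y => F (enc (n, a n, y))) (D.accepts n) = prob W (D'.accepts n) := by
    intro W n
    rw [prob, PMF.toOuterMeasure_map_apply, prob]
    rfl
  simpa only [key] using h D'

/-- Non-uniformity replaces sampling of `W`: for each `n` a sample of `W n` with at least half of
the distinguishing advantage is fixed and supplied as advice, so `W` needs no efficient sampler,
only samples of polynomial size. -/
theorem node_left {W : ℕ → PMF Data} (h : EnsIndist X Y) (hW : PolySized W) :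
    EnsIndist (fun n => (W n).bind fun w => (X n).map fun y => .node w y)
      (fun n => (W n).bind fun w => (Y n).map fun y => .node w y) := by
  intro D
  obtain ⟨q, hq⟩ := hW
  choose w hw hle using fun n => exists_abs_prob_bind_sub_le (W n)
    (fun w => (X n).map fun y => Data.node w y) (fun w => (Y n).map fun y => Data.node w y)
    (D.accepts n)
  have := h.map_advice w ⟨q, fun n => hq n _ (hw n)⟩ (F := fun x => .node x.tl.hd x.tl.tl)
    (.node IsPolyTime.id.tl.hd IsPolyTime.id.tl.tl)
  refine ((this D).const_mul 2).mono fun n => ?_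
  rw [abs_abs]
  exact hle n

theorem node_right {W : ℕ → PMF Data} (h : EnsIndist X Y) (hW : PolySized W) :
    EnsIndist (fun n => (X n).bind fun x => (W n).map fun w => .node x w)
      (fun n => (Y n).bind fun x => (W n).map fun w => .node x w) := by
  have comm : ∀ V : PMF Data, ∀ n, (V.bind fun x => (W n).map fun w => Data.node x w) =
      ((W n).bind fun w => V.map fun x => Data.node w x).map fun y => .node y.tl y.hd := by
    intro V n
    rw [PMF.map_bind]
    simp only [PMF.map_comp, Function.comp_def, Data.hd_node, Data.tl_node]
    simp only [← PMF.bind_pure_comp, Function.comp_def]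
    rw [PMF.bind_comm]
  simp only [comm]
  exact (h.node_left hW).map_advice (fun _ => .nil) (.const 1)
    (F := fun x => .node x.tl.tl.tl x.tl.tl.hd) (.node IsPolyTime.id.tl.tl.tl IsPolyTime.id.tl.tl.hd)

/-- Independent pairs of indistinguishable ensembles are indistinguishable. -/
theorem node {X' Y' : ℕ → PMF Data} (h : EnsIndist X Y) (h' : EnsIndist X' Y')
    (hX : PolySized X') (hY : PolySized Y) :
    EnsIndist (fun n => (X n).bind fun x => (X' n).map fun w => .node x w)
      (fun n => (Y n).bind fun x => (Y' n).map fun w => .node x w) :=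
  -- The intermediate hybrid pairs `Y` with `X'`; each of the two steps keeps one component, `X'`
  -- and then `Y`, and needs its size bounded.
  (h.node_right hX).trans (h'.node_left hY)

end EnsIndist

/-! ## Closure properties of probabilistic polynomial-time algorithms -/

theorem toList_enc_bits {k : ℕ} (r : Fin k → Bool) : (enc r).toList = (List.ofFn r).map enc :=
  Data.toList_ofList _

theorem ofList_take_enc_append {a b : ℕ} (r : Fin a → Bool) (r' : Fin b → Bool) :
    Data.ofList ((enc (Fin.append r r')).toList.take (enc a).toList.length) = enc r := by
  rw [toList_enc_bits, List.ofFn_fin_append, enc_nat_toList, List.map_append,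
    List.take_left' (by simp)]
  rfl

theorem ofList_drop_enc_append {a b : ℕ} (r : Fin a → Bool) (r' : Fin b → Bool) :
    Data.ofList ((enc (Fin.append r r')).toList.drop (enc a).toList.length) = enc r' := by
  rw [toList_enc_bits, List.ofFn_fin_append, enc_nat_toList, List.map_append,
    List.drop_left' (by simp)]
  rfl

theorem size_enc_bits_le {k : ℕ} (r : Fin k → Bool) : (enc r).size ≤ 1 + k * 4 :=
  size_enc_pi_le r 3 fun i => by cases r i <;> simp [enc, Data.size]

namespace PPT

/-- A deterministic algorithm. -/
def ofPolyTime {F : Data → Data} (hF : IsPolyTime F) : PPT where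
  coins _ := 0
  run y := F y.hd
  coins_polyTime := .const _
  run_polyTime := hF.comp IsPolyTime.id.hd

theorem dist_ofPolyTime {F : Data → Data} (hF : IsPolyTime F) (x : Data) :
    (ofPolyTime hF).dist x = PMF.pure (F x) :=
  PMF.map_const (PMF.uniformOfFintype (Fin 0 → Bool)) (F x)

/-- Preprocessing of the input. -/
def precomp (A : PPT) {F : Data → Data} (hF : IsPolyTime F) : PPT where
  coins x := A.coins (F x)
  run y := A.run (.node (F y.hd) y.tl)
  coins_polyTime := A.coins_polyTime.comp hF
  run_polyTime := A.run_polyTime.comp (.node (hF.comp IsPolyTime.id.hd) IsPolyTime.id.tl)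

theorem dist_precomp (A : PPT) {F : Data → Data} (hF : IsPolyTime F) (x : Data) :
    (A.precomp hF).dist x = A.dist (F x) := rfl

/-- Postprocessing of the output. -/
def postcomp (A : PPT) {G : Data → Data} (hG : IsPolyTime G) : PPT where
  coins := A.coins
  run y := G (.node y.hd (A.run y))
  coins_polyTime := A.coins_polyTime
  run_polyTime := hG.comp (.node IsPolyTime.id.hd A.run_polyTime)

theorem dist_postcomp (A : PPT) {G : Data → Data} (hG : IsPolyTime G) (x : Data) :
    (A.postcomp hG).dist x = (A.dist x).map fun y => G (.node x y) := by
  rw [PPT.dist, PPT.dist, PMF.map_comp]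
  rfl

/-- Two algorithms run independently on the same input. -/
def pair (A B : PPT) : PPT where
  coins x := A.coins x + B.coins x
  run y := .node
    -- The coins are split at the number used by `A`, recomputed from the input in unary so that its
    -- code serves as a counter.
    (A.run (.node y.hd (.ofList (y.tl.toList.take (enc (A.coins y.hd)).toList.length))))
    (B.run (.node y.hd (.ofList (y.tl.toList.drop (enc (A.coins y.hd)).toList.length))))
  coins_polyTime := by
    simp only [enc_nat_add]
    exact A.coins_polyTime.append B.coins_polyTime
  run_polyTime := by
    have h := A.coins_polyTime.comp IsPolyTime.id.hd
    exact .node (A.run_polyTime.comp (.node IsPolyTime.id.hd (h.take IsPolyTime.id.tl)))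
      (B.run_polyTime.comp (.node IsPolyTime.id.hd (h.drop IsPolyTime.id.tl)))

theorem dist_pair (A B : PPT) (x : Data) :
    (A.pair B).dist x = (A.dist x).bind fun a => (B.dist x).map fun b => .node a b := by
  have h := uniformOfFintype_map_equiv (Fin.appendEquiv (α := Bool) (A.coins x) (B.coins x))
  rw [uniformOfFintype_prod] at h
  have h2 : (A.pair B).dist x = (PMF.uniformOfFintype (Fin (A.coins x + B.coins x) → Bool)).map
      fun r => (A.pair B).run (enc (x, r)) := rfl
  rw [h2, ← h, PMF.map_comp, PMF.map_bind, PPT.dist, PMF.bind_map]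
  congr 1
  funext r
  simp only [PMF.map_comp, Function.comp_def, PPT.dist]
  congr 1
  funext r'
  simp only [pair, enc_prod, enc_data, Data.hd_node, Data.tl_node, Fin.appendEquiv,
    Equiv.coe_fn_mk, ofList_take_enc_append, ofList_drop_enc_append]

theorem polySized_dist (A : PPT) {x : ℕ → Data} (hx : PolyBounded fun n => (x n).size) :
    PolySized fun n => A.dist (x n) := by
  obtain ⟨q, hq⟩ := A.run_polyTime.size_le
  obtain ⟨c, hc⟩ := A.coins_polyTime.size_le
  -- Each coin occupies at most `4` nodes (a bit of size at most `3` and a list node); the `2` is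
  -- for the end of the coin list and the pairing with the input.
  obtain ⟨b, hb⟩ := (((hx.add ((hx.poly c).const_mul 4)).add (.const 2)).poly q)
  refine ⟨b, fun n y hy => ?_⟩
  obtain ⟨r, _, rfl⟩ := (PMF.mem_support_map_iff _ _ _).1 hy
  refine ((hq _).trans (monotone_natPolynomial_eval q ?_)).trans (hb n)
  have h1 := size_enc_bits_le r
  have h2 := hc (x n)
  rw [size_enc_nat] at h2
  simp only [enc_prod, Data.size, enc_data]
  omega

end PPT

/-! ## The sets of the clients when all instances of EG-PSI are correct -/

section Ideal

variable {z : ℕ}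

/-- The sets after `d` levels: an element stays with the last of its owners in each block of `2 ^ d`
clients. -/
def idealSets (S : Sets (2 ^ z)) (d : ℕ) : Sets (2 ^ z) := fun i =>
  (S i).filter fun e => ∀ j, i < j → (j : ℕ) / 2 ^ d = (i : ℕ) / 2 ^ d → e ∉ S j

/-- The sets of the clients of a cluster before level `d`. -/
def idealCluster (S : Sets (2 ^ z)) (d : ℕ) (c : Fin (2 ^ z / 2 ^ (d + 1))) : GSets (2 ^ d) :=
  fun g l => idealSets S d (member c g l)

/-- The vector that client `i` receives at level `d`. -/
def idealVec (S : Sets (2 ^ z)) {d : ℕ} (hd : d < z) (i : Fin (2 ^ z)) :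
    Fin (2 ^ d) → Finset Elem :=
  gpsiVec (idealCluster S d (cluster hd i)) (group d i) (position d i)

theorem mem_idealSets {S : Sets (2 ^ z)} {d : ℕ} {i : Fin (2 ^ z)} {e : Elem} :
    e ∈ idealSets S d i ↔
      e ∈ S i ∧ ∀ j, i < j → (j : ℕ) / 2 ^ d = (i : ℕ) / 2 ^ d → e ∉ S j :=
  Finset.mem_filter

theorem idealSets_subset (S : Sets (2 ^ z)) (d : ℕ) (i : Fin (2 ^ z)) : idealSets S d i ⊆ S i :=
  Finset.filter_subset _ _

theorem idealSets_zero (S : Sets (2 ^ z)) : idealSets S 0 = S := by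
  funext i
  ext e
  rw [mem_idealSets]
  refine and_iff_left fun j hij h => absurd h ?_
  have : (i : ℕ) < j := hij
  simp; omega

theorem exists_mem_idealSets {S : Sets (2 ^ z)} (d : ℕ) {j : Fin (2 ^ z)} {e : Elem}
    (he : e ∈ S j) : ∃ l : Fin (2 ^ z), (l : ℕ) / 2 ^ d = (j : ℕ) / 2 ^ d ∧ e ∈ idealSets S d l := by
  -- The owner of `e` with the largest index in the block of `j`.
  obtain ⟨l, hl, hmax⟩ := (Finset.univ.filter fun l : Fin (2 ^ z) =>
    (l : ℕ) / 2 ^ d = (j : ℕ) / 2 ^ d ∧ e ∈ S l).exists_max_image id ⟨j, by simp [he]⟩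
  rw [Finset.mem_filter] at hl
  refine ⟨l, hl.2.1, mem_idealSets.2 ⟨hl.2.2, fun k hk hkl hek => ?_⟩⟩
  exact absurd (hmax k (by simp [hek, hkl, hl.2.1])) (not_le.2 hk)

/-- Of two owners in one block, the one of smaller index has given the element up. With blocks of
size `2 ^ d` this is the disjointness that G-PSI requires of a group. -/
theorem disjoint_idealSets (S : Sets (2 ^ z)) {d : ℕ} {i j : Fin (2 ^ z)} (hij : i ≠ j)
    (h : (i : ℕ) / 2 ^ d = (j : ℕ) / 2 ^ d) : Disjoint (idealSets S d i) (idealSets S d j) := by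
  rw [Finset.disjoint_left]
  intro e hi hj
  rw [mem_idealSets] at hi hj
  rcases lt_or_gt_of_ne hij with hlt | hlt
  · exact hi.2 j hlt h.symm hj.1
  · exact hj.2 i hlt h hi.1

theorem member_div {d : ℕ} (c : Fin (2 ^ z / 2 ^ (d + 1))) (g : Fin 2) (l : Fin (2 ^ d)) :
    (member c g l : ℕ) / 2 ^ d = 2 * c + g := by
  have h : (member c g l : ℕ) = l + 2 ^ d * (2 * c + g) := by
    simp only [member, pow_succ]; ring
  rw [h, Nat.add_mul_div_left _ _ (Nat.two_pow_pos d), Nat.div_eq_of_lt l.isLt, zero_add]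

theorem member_injective {d : ℕ} (c : Fin (2 ^ z / 2 ^ (d + 1))) (g : Fin 2) :
    Function.Injective (member c g : Fin (2 ^ d) → Fin (2 ^ z)) := by
  intro l l' h
  have := congrArg Fin.val h
  simp only [member] at this
  exact Fin.ext (by omega)

theorem admissible_idealCluster {U : ℕ → Set Elem} {n : ℕ} {S : Sets (2 ^ z)}
    (hS : S.Admissible U n) (d : ℕ) (c : Fin (2 ^ z / 2 ^ (d + 1))) :
    (idealCluster S d c).Admissible U n := by
  refine ⟨fun g l e he => hS _ e (idealSets_subset S d _ he), fun g l l' hl => ?_⟩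
  exact disjoint_idealSets S ((member_injective c g).ne hl) (by rw [member_div, member_div])

theorem mem_update_enc {k : ℕ} (S : Finset Elem) (v : Fin k → Finset Elem) (e : Elem) :
    e ∈ update S (enc v) ↔ e ∈ S ∧ ∀ l, e ∉ v l := by
  have h : (enc v).toList = (List.ofFn v).map enc := Data.toList_ofList _
  simp [update, h, List.mem_ofFn, mem_toList_enc_finset enc_elem_injective]

theorem idealCluster_self (S : Sets (2 ^ z)) {d : ℕ} (hd : d < z) (i : Fin (2 ^ z)) :
    idealCluster S d (cluster hd i) (group d i) (position d i) = idealSets S d i := by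
  rw [idealCluster, member_cluster]

theorem idealVec_apply (S : Sets (2 ^ z)) {d : ℕ} (hd : d < z) (i : Fin (2 ^ z))
    (l : Fin (2 ^ d)) : idealVec S hd i l =
      idealSets S d i ∩ idealSets S d (member (cluster hd i) (1 - group d i) l) := by
  rw [idealVec, gpsiVec, idealCluster_self]
  rfl

/-- A block of size `2 ^ (d + 1)` consists of group 0 followed by group 1. Enlarging the block adds
no later clients for a member of group 1. For a member of group 0 it adds all of group 1, and an
element owned there is still held by its last owner in that group, so it shows up in the vector and
is removed. -/
theorem idealSets_succ (S : Sets (2 ^ z)) {d : ℕ} (hd : d < z) (i : Fin (2 ^ z)) :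
    (if group d i = 0 then update (idealSets S d i) (enc (idealVec S hd i))
      else idealSets S d i) = idealSets S (d + 1) i := by
  have hdiv : ∀ j : ℕ, j / 2 ^ (d + 1) = j / 2 ^ d / 2 := fun j => by
    rw [pow_succ, Nat.div_div_eq_div_mul]
  have hmono : ∀ j : Fin (2 ^ z), i < j → (i : ℕ) / 2 ^ d ≤ (j : ℕ) / 2 ^ d := fun j hj =>
    Nat.div_le_div_right (Fin.le_def.1 hj.le)
  have hval : (group d i : ℕ) = (i : ℕ) / 2 ^ d % 2 := rfl
  ext e
  by_cases hg : group d i = 0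
  · rw [if_pos hg, mem_update_enc]
    have h0 : (i : ℕ) / 2 ^ d % 2 = 0 := by rw [← hval, hg]; rfl
    constructor
    · rintro ⟨he, hv⟩
      rw [mem_idealSets] at he ⊢
      refine ⟨he.1, fun j hj hblock hej => ?_⟩
      by_cases hsame : (j : ℕ) / 2 ^ d = (i : ℕ) / 2 ^ d
      · exact he.2 j hj hsame hej
      -- The later owner `j` lies in group 1 and may itself have lost `e`, but some client `l` of
      -- its group still has it.
      · obtain ⟨l, hl, hel⟩ := exists_mem_idealSets d hej
        have hm := hmono j hj
        rw [hdiv, hdiv] at hblock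
        have hc : cluster hd l = cluster hd i := by
          apply Fin.ext
          simp only [cluster, hdiv]
          omega
        have hgl : group d l = 1 - group d i := by
          rw [hg]
          apply Fin.ext
          change (l : ℕ) / 2 ^ d % 2 = 1
          omega
        apply hv (position d l)
        rw [idealVec_apply, ← hc, ← hgl, member_cluster, Finset.mem_inter]
        exact ⟨mem_idealSets.2 he, hel⟩
    · intro he
      rw [mem_idealSets] at he
      refine ⟨mem_idealSets.2 ⟨he.1, fun j hj h => he.2 j hj (by rw [hdiv, hdiv, h])⟩,
        fun l hl => ?_⟩
      rw [idealVec_apply, Finset.mem_inter] at hl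
      have hm := member_div (cluster hd i) (1 - group d i) l
      rw [hg] at hm hl
      have hc : (cluster hd i : ℕ) = (i : ℕ) / 2 ^ d / 2 := hdiv i
      rw [hc] at hm
      change _ = 2 * _ + 1 at hm
      refine he.2 _ ?_ ?_ (idealSets_subset S d _ hl.2)
      · by_contra hle
        have := Nat.div_le_div_right (c := 2 ^ d) (Fin.le_def.1 (not_lt.1 hle))
        rw [show (1 - 0 : Fin 2) = 1 from rfl] at this
        rw [show (1 - 0 : Fin 2) = 1 from rfl] at hm
        omega
      · rw [hdiv, hdiv]
        rw [hm]
        omega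
  · rw [if_neg hg, mem_idealSets, mem_idealSets]
    have h1 : (i : ℕ) / 2 ^ d % 2 = 1 := by
      have : (group d i : ℕ) ≠ 0 := fun h => hg (Fin.ext h)
      omega
    refine and_congr_right fun _ => forall_congr' fun j => forall_congr' fun hj => ?_
    have hm := hmono j hj
    rw [hdiv, hdiv]
    refine imp_congr_left ⟨fun h => by rw [h], fun h => by omega⟩

/-- At `d = z` all clients form one block, so the sets are pairwise disjoint and the sum of their
multisets is that of their union. -/
theorem isDedup_idealSets (S : Sets (2 ^ z)) : IsDedup S (idealSets S z) := by
  refine ⟨idealSets_subset S z, ?_⟩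
  have hblock : ∀ i : Fin (2 ^ z), (i : ℕ) / 2 ^ z = 0 := fun i => Nat.div_eq_of_lt i.isLt
  have hdisj : ((Finset.univ : Finset (Fin (2 ^ z))) : Set (Fin (2 ^ z))).PairwiseDisjoint
      (idealSets S z) := fun i _ j _ hij =>
    disjoint_idealSets S hij (by rw [hblock, hblock])
  have h : Finset.univ.disjiUnion (idealSets S z) hdisj = Finset.univ.biUnion S := by
    ext e
    simp only [Finset.mem_disjiUnion, Finset.mem_biUnion, Finset.mem_univ, true_and]
    constructor
    · rintro ⟨i, hi⟩
      exact ⟨i, idealSets_subset S z i hi⟩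
    · rintro ⟨j, hj⟩
      obtain ⟨l, _, hl⟩ := exists_mem_idealSets z hj
      exact ⟨l, hl⟩
  rw [← h, Finset.disjiUnion_val]
  rfl

end Ideal

/-! ## Reconstructing the inputs and outputs of a client from the leakage -/

theorem mem_leakageW {m : ℕ} {S : Sets m} {i l : Fin m} {r : Elem} :
    toLex (r, toLex (i, l)) ∈ leakageW S (redundancy S) i ↔ l ≠ i ∧ r ∈ S i ∧ r ∈ S l := by
  simp only [leakageW, redundancy, Finset.mem_biUnion, Finset.mem_image, Finset.mem_filter,
    Finset.mem_erase, Finset.mem_univ, and_true]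
  constructor
  · rintro ⟨l', hl', r', ⟨_, h⟩, heq⟩
    obtain ⟨rfl, h2⟩ := Prod.mk.inj (toLex.injective heq)
    obtain ⟨_, rfl⟩ := Prod.mk.inj (toLex.injective h2)
    exact ⟨hl', h⟩
  · rintro ⟨hl, h⟩
    exact ⟨l, hl, r, ⟨⟨h.1, l, hl, h.2⟩, h⟩, rfl⟩

/-- Whether the leakage `x.hd` to client `i` tells that client `j` has the element `x.tl`. -/
def leakMem {m : ℕ} (i j : Fin m) (x : Data) : Bool :=
  -- The leakage has no triples with `l = i`; the predicate is only evaluated on elements of the set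
  -- of client `i`.
  if j = i then true else decide (Data.node x.tl (.node (enc i) (enc j)) ∈ x.hd.toList)

theorem isPolyTimePred_leakMem {m : ℕ} (i j : Fin m) : IsPolyTimePred (leakMem i j) := by
  unfold leakMem
  by_cases h : j = i
  · simpa only [h, if_true] using IsPolyTimePred.const true
  · simp only [h, if_false]
    exact .mem (.node IsPolyTime.id.tl (.const _)) IsPolyTime.id.hd

theorem leakMem_enc {m : ℕ} (S : Sets m) (i j : Fin m) {e : Elem} (he : e ∈ S i) :
    leakMem i j (.node (enc (leakageW S (redundancy S) i)) (enc e)) = decide (e ∈ S j) := by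
  unfold leakMem
  split_ifs with h
  · subst h; simp [he]
  · rw [decide_eq_decide]
    have := mem_toList_enc_finset enc_triple_injective (leakageW S (redundancy S) i)
      (toLex (e, toLex (i, j)))
    rw [mem_leakageW] at this
    exact this.trans ⟨fun h' => h'.2.2, fun h' => ⟨h, he, h'⟩⟩

/-- Whether, by the leakage `x.hd` to client `i`, client `l` still has `x.tl` before level `d`. -/
noncomputable def leakIdeal {z : ℕ} (i : Fin (2 ^ z)) (d : ℕ) (l : Fin (2 ^ z)) (x : Data) : Bool :=
  leakMem i l x && (Finset.univ.filter fun j : Fin (2 ^ z) =>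
    l < j ∧ (j : ℕ) / 2 ^ d = (l : ℕ) / 2 ^ d).toList.all fun j => !leakMem i j x

theorem isPolyTimePred_leakIdeal {z : ℕ} (i : Fin (2 ^ z)) (d : ℕ) (l : Fin (2 ^ z)) :
    IsPolyTimePred (leakIdeal i d l) :=
  (isPolyTimePred_leakMem i l).and (.all _ fun j => (isPolyTimePred_leakMem i j).not)

theorem leakIdeal_enc {z : ℕ} (S : Sets (2 ^ z)) (i : Fin (2 ^ z)) (d : ℕ) (l : Fin (2 ^ z))
    {e : Elem} (he : e ∈ S i) :
    leakIdeal i d l (.node (enc (leakageW S (redundancy S) i)) (enc e)) =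
      decide (e ∈ idealSets S d l) := by
  rw [Bool.eq_iff_iff]
  simp [leakIdeal, leakMem_enc S i _ he, mem_idealSets]

theorem IsPolyTime.ofList_map {α : Type} (l : List α) {f : α → Data → Data}
    (hf : ∀ a, IsPolyTime (f a)) : IsPolyTime fun x => .ofList (l.map fun a => f a x) := by
  induction l with
  | nil => exact .const .nil
  | cons a l ih => exact (hf a).node ih

/-- Client `i` can compute its ideal input to level `d` and its ideal output from its input and the
leakage. -/
theorem exists_polyTime_ideal {z d : ℕ} (hd : d < z) (i : Fin (2 ^ z)) :
    ∃ F : Data → Data, IsPolyTime F ∧ ∀ (n : ℕ) (S S' : Sets (2 ^ z)),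
      F (enc (n, enc (S i, S' i, leakageW S (redundancy S) i))) =
        enc (n, enc (idealSets S d i, idealVec S hd i)) := by
  -- Ideal set and vector entries are subsets of `S i`, so all arise by filtering its code
  -- `x.tl.hd`; the leakage sits at `x.tl.tl.tl`.
  let sel : (Data → Data → Bool) → Data → Data := fun p x =>
    .ofList (x.tl.hd.toList.filter (p x.tl.tl.tl))
  have hsel : ∀ p : Data → Bool, IsPolyTimePred p → IsPolyTime (sel fun a b => p (.node a b)) :=
    fun p hp => IsPolyTime.filter (p := fun a b => p (.node a b))
      (hp.comp (.node IsPolyTime.id.hd IsPolyTime.id.tl)) IsPolyTime.id.tl.tl.tl IsPolyTime.id.tl.hd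
  let m : Fin (2 ^ d) → Fin (2 ^ z) := member (cluster hd i) (1 - group d i)
  refine ⟨fun x => .node x.hd (.node (sel (fun a b => leakIdeal i d i (.node a b)) x)
    (.ofList ((List.finRange (2 ^ d)).map fun l =>
      sel (fun a b => leakIdeal i d i (.node a b) && leakIdeal i d (m l) (.node a b)) x))),
    .node IsPolyTime.id.hd (.node (hsel _ (isPolyTimePred_leakIdeal i d i))
      (.ofList_map _ fun l => hsel (fun x => leakIdeal i d i x && leakIdeal i d (m l) x)
        ((isPolyTimePred_leakIdeal i d i).and (isPolyTimePred_leakIdeal i d (m l))))), ?_⟩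
  intro n S S'
  have h1 : enc (idealSets S d i) = .ofList ((enc (S i)).toList.filter fun e =>
      leakIdeal i d i (.node (enc (leakageW S (redundancy S) i)) e)) := by
    have : idealSets S d i = (S i).filter fun e => e ∈ idealSets S d i := by
      ext e
      rw [Finset.mem_filter]
      exact ⟨fun h => ⟨idealSets_subset S d i h, h⟩, fun h => h.2⟩
    conv_lhs => rw [this]
    exact enc_finset_filter _ _ _ fun e he => leakIdeal_enc S i d i he
  have h2 : ∀ l, enc (idealVec S hd i l) = .ofList ((enc (S i)).toList.filter fun e =>
      leakIdeal i d i (.node (enc (leakageW S (redundancy S) i)) e) &&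
        leakIdeal i d (m l) (.node (enc (leakageW S (redundancy S) i)) e)) := by
    intro l
    have : idealVec S hd i l =
        (S i).filter fun e => e ∈ idealSets S d i ∧ e ∈ idealSets S d (m l) := by
      ext e
      rw [Finset.mem_filter, idealVec_apply, Finset.mem_inter]
      exact ⟨fun h => ⟨idealSets_subset S d i h.1, h⟩, fun h => h.2⟩
    rw [this]
    refine enc_finset_filter _ _ _ fun e he => ?_
    rw [leakIdeal_enc S i d i he, leakIdeal_enc S i d (m l) he, Bool.decide_and]
  have h3 : enc (idealVec S hd i) =
      .ofList ((List.finRange (2 ^ d)).map fun l => enc (idealVec S hd i l)) := by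
    change Data.ofList ((List.ofFn (idealVec S hd i)).map enc) = _
    rw [List.ofFn_eq_map, List.map_map]
    rfl
  simp only [sel, enc_prod, enc_data, Data.hd_node, Data.tl_node, h1, h3, h2]

/-! ## Executions in which all instances of EG-PSI run on the ideal sets -/

section IdealExecution

variable {z : ℕ} (Γ : (k : ℕ) → Protocol (GParty k)) (n : ℕ) (S : Sets (2 ^ z))

/-- The coins of level `d` on the ideal sets. -/
abbrev IdealCoins (d : ℕ) : Type :=
  (c : Fin (2 ^ z / 2 ^ (d + 1))) → (Γ (2 ^ d)).Coins n (gpsiInput (idealCluster S d c))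

theorem exec_idealCluster {d : ℕ} (c : Fin (2 ^ z / 2 ^ (d + 1))) :
    (Γ (2 ^ d)).exec n (gpsiInput (idealCluster S d c)) =
      (PMF.uniformOfFintype (IdealCoins Γ n S d)).map
        fun r => (Γ (2 ^ d)).outcome n _ (r c) := by
  have h := congrArg (PMF.map ((Γ (2 ^ d)).outcome n (gpsiInput (idealCluster S d c))))
    (uniformOfFintype_map_eval
      (A := fun c => (Γ (2 ^ d)).Coins n (gpsiInput (idealCluster S d c))) c)
  rw [PMF.map_comp] at h
  refine Eq.trans ?_ h.symm
  unfold Protocol.exec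
  congr!

/-- The views of the clients at level `d` on the ideal sets. -/
noncomputable def idealLevel {d : ℕ} (hd : d < z) : PMF (Fin (2 ^ z) → Data) :=
  (PMF.uniformOfFintype (IdealCoins Γ n S d)).map fun r i =>
    ((Γ (2 ^ d)).outcome n _ (r (cluster hd i)) (some (group d i, position d i))).1

/-- The views of the clients in the first `d` levels. -/
noncomputable def idealViews : (d : ℕ) → d ≤ z → PMF (Fin (2 ^ z) → List Data)
  | 0, _ => PMF.pure fun _ => []
  | d + 1, hd => (idealViews d (Nat.le_of_succ_le hd)).bind fun vs =>
      (idealLevel Γ n S hd).map fun v i => vs i ++ [v i]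

/-- The outputs of client `i` in the first `d` levels. -/
def idealOutputs (i : Fin (2 ^ z)) : (d : ℕ) → d ≤ z → List Data
  | 0, _ => []
  | d + 1, hd => idealOutputs i d (Nat.le_of_succ_le hd) ++ [enc (idealVec S hd i)]

/-- The state after `d` levels on the ideal sets, with given views. -/
def idealState (d : ℕ) (hd : d ≤ z) (vs : Fin (2 ^ z) → List Data) : State z where
  sets := idealSets S d
  views := vs
  outputs := fun i => idealOutputs S i d hd

/-- The coins of level `d` for which some instance of EG-PSI errs. -/
def errCoins (d : ℕ) : Set (IdealCoins Γ n S d) :=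
  {r | ∃ c, ¬ ∀ p, ((Γ (2 ^ d)).outcome n _ (r c) p).2 = gpsi (idealCluster S d c) p}

/-- The probability that some instance of EG-PSI errs at level `d`. -/
noncomputable def errProb (d : ℕ) : ℝ≥0∞ :=
  (PMF.uniformOfFintype (IdealCoins Γ n S d)).toOuterMeasure (errCoins Γ n S d)

/-- On ideal sets the real level uses the coin space `IdealCoins`. Outside `errCoins` every client
receives its ideal vector, and `idealSets_succ` gives the next sets. -/
theorem statClose_level {d : ℕ} (hd : d < z) (vs : Fin (2 ^ z) → List Data) :
    StatClose (level Γ n hd (idealState S d hd.le vs))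
      ((idealLevel Γ n S hd).map fun v => idealState S (d + 1) hd fun i => vs i ++ [v i])
      (errProb Γ n S d) := by
  rw [idealLevel, PMF.map_comp]
  refine StatClose.of_eq_on_compl (PMF.uniformOfFintype (IdealCoins Γ n S d))
    (levelStep Γ n hd (idealState S d hd.le vs)) _ (errCoins Γ n S d) fun r hr => ?_
  have hout : ∀ i, ((Γ (2 ^ d)).outcome n _ (r (cluster hd i))
      (some (group d i, position d i))).2 = enc (idealVec S hd i) := by
    intro i
    by_contra h
    exact hr ⟨cluster hd i, fun h' => h (h' _)⟩
  have hsets : (levelStep Γ n hd (idealState S d hd.le vs) r).sets = idealSets S (d + 1) := by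
    funext i
    rw [← idealSets_succ S hd i, ← hout i]
    rfl
  have houts : (levelStep Γ n hd (idealState S d hd.le vs) r).outputs =
      fun i => idealOutputs S i (d + 1) hd := by
    funext i
    rw [idealOutputs, ← hout i]
    rfl
  exact congrArg₂ (fun a b => State.mk a _ b) hsets houts

/-- Union bound over the clusters, each of which is a plain run of EG-PSI. -/
theorem errProb_le (d : ℕ) : errProb Γ n S d ≤ ∑ c : Fin (2 ^ z / 2 ^ (d + 1)),
    ((Γ (2 ^ d)).exec n (gpsiInput (idealCluster S d c))).toOuterMeasure
      {o | ¬ ∀ p, (o p).2 = gpsi (idealCluster S d c) p} := by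
  have h : errCoins Γ n S d = ⋃ c, {r | ¬ ∀ p,
      ((Γ (2 ^ d)).outcome n _ (r c) p).2 = gpsi (idealCluster S d c) p} := by
    ext r; simp [errCoins]
  rw [errProb, h]
  refine (MeasureTheory.measure_iUnion_fintype_le _ _).trans (Finset.sum_le_sum fun c _ => ?_)
  rw [exec_idealCluster, PMF.toOuterMeasure_map_apply]
  exact le_rfl

/-- The view of client `i` in its instance of EG-PSI at level `d` on the ideal sets. -/
noncomputable def idealView {d : ℕ} (hd : d < z) (i : Fin (2 ^ z)) : PMF Data :=
  ((Γ (2 ^ d)).exec n (gpsiInput (idealCluster S d (cluster hd i)))).map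
    fun o => (o (some (group d i, position d i))).1

/-- A list, as a tree, with an entry added at the end. -/
def snoc (l v : Data) : Data := .ofList (l.toList ++ [v])

/-- The views of client `i` in the first `d` levels on the ideal sets. -/
noncomputable def clientViews (i : Fin (2 ^ z)) : (d : ℕ) → d ≤ z → PMF Data
  | 0, _ => PMF.pure .nil
  | d + 1, hd => (clientViews i d (Nat.le_of_succ_le hd)).bind fun l =>
      (idealView Γ n S hd i).map fun v => snoc l v

theorem idealLevel_map_eval {d : ℕ} (hd : d < z) (i : Fin (2 ^ z)) :
    (idealLevel Γ n S hd).map (fun v => v i) = idealView Γ n S hd i := by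
  rw [idealLevel, idealView, exec_idealCluster, PMF.map_comp, PMF.map_comp]
  rfl

theorem enc_append_singleton (l : List Data) (v : Data) : enc (l ++ [v]) = snoc (enc l) v := by
  simp [snoc, enc_list, Data.toList_ofList, enc_data]

/-- Clients of one cluster have correlated views, but levels are independent, so the marginal of one
client is built from its marginals at the single levels. -/
theorem idealViews_map_eval (i : Fin (2 ^ z)) (d : ℕ) (hd : d ≤ z) :
    (idealViews Γ n S d hd).map (fun vs => enc (vs i)) = clientViews Γ n S i d hd := by
  induction d with
  | zero => exact PMF.pure_map _ _
  | succ d ih =>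
    rw [idealViews, clientViews, ← ih, PMF.map_bind, PMF.bind_map]
    congr 1
    funext vs
    rw [Function.comp_apply, ← idealLevel_map_eval, PMF.map_comp, PMF.map_comp]
    simp only [Function.comp_def, enc_append_singleton]

end IdealExecution

/-! ### Size bounds, simulation of a client's views, and the passage to the ideal execution -/

section Main

variable {z : ℕ} {U : ℕ → Set Elem} {Γ : (k : ℕ) → Protocol (GParty k)}

theorem size_enc_idealSets_le (S : Sets (2 ^ z)) (d : ℕ) (i : Fin (2 ^ z)) :
    (enc (idealSets S d i)).size ≤ (enc S).size :=
  (size_enc_finset_mono (idealSets_subset S d i)).trans (size_enc_le_pi S i)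

theorem size_enc_idealVec_le (S : Sets (2 ^ z)) {d : ℕ} (hd : d < z) (i : Fin (2 ^ z)) :
    (enc (idealVec S hd i)).size ≤ 1 + 2 ^ d * (1 + (enc S).size) :=
  size_enc_pi_le _ _ fun l => by
    rw [idealVec_apply]
    exact (size_enc_finset_mono Finset.inter_subset_left).trans (size_enc_idealSets_le S d i)

theorem size_enc_idealCluster_le (S : Sets (2 ^ z)) (d : ℕ) (c : Fin (2 ^ z / 2 ^ (d + 1))) :
    (enc (idealCluster S d c)).size ≤ 1 + 2 * (1 + (1 + 2 ^ d * (1 + (enc S).size))) :=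
  size_enc_pi_le _ _ fun _ => size_enc_pi_le _ _ fun _ => size_enc_idealSets_le S d _

theorem PolyBounded.affine {f : ℕ → ℕ} (hf : PolyBounded f) (k : ℕ) :
    PolyBounded fun n => 1 + k * (1 + f n) :=
  (PolyBounded.const 1).add (((PolyBounded.const 1).add hf).const_mul k)

theorem isInputFamily_idealCluster {s : ℕ → Sets (2 ^ z)}
    (hs : IsInputFamily (Sets.Admissible U) s) (d : ℕ) (c : Fin (2 ^ z / 2 ^ (d + 1))) :
    IsInputFamily (GSets.Admissible U) fun n => idealCluster (s n) d c :=
  ⟨fun n => admissible_idealCluster (hs.1 n) d c,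
    ((hs.2.affine (2 ^ d)).affine 2).mono fun n => size_enc_idealCluster_le (s n) d c⟩

theorem polyBounded_size_gpsiInput {s : ℕ → Sets (2 ^ z)}
    (hs : PolyBounded fun n => (enc (s n)).size) (d : ℕ) (c : Fin (2 ^ z / 2 ^ (d + 1))) :
    PolyBounded fun n => ∑ q, (gpsiInput (idealCluster (s n) d c) q).size := by
  refine ((hs.add (.const 1)).const_mul
    (Finset.univ : Finset (GParty (2 ^ d))).card).mono fun n => ?_
  refine (Finset.sum_le_card_nsmul _ _ ((enc (s n)).size + 1) fun q _ => ?_).trans ?_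
  · match q with
    | some (g, l) => exact (size_enc_idealSets_le (s n) d (member c g l)).trans (Nat.le_succ _)
    | none =>
      have : (gpsiInput (idealCluster (s n) d c) none).size = 1 := by
        change (enc (∅ : Finset Elem)).size = 1
        rw [size_enc_finset]; simp
      omega
  · exact le_of_eq (mul_comm _ _) |>.trans (le_of_eq (mul_comm _ _))

/-- The polynomial bound on views in `IsPPT` enters here; it makes real views usable as advice in
the hybrid argument. -/
theorem polySized_idealView {d : ℕ} (hd : d < z) (hppt : (Γ (2 ^ d)).IsPPT)
    {s : ℕ → Sets (2 ^ z)} (hs : PolyBounded fun n => (enc (s n)).size) (i : Fin (2 ^ z)) :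
    PolySized fun n => idealView Γ n (s n) hd i := by
  obtain ⟨b, hb⟩ := hppt.view
  obtain ⟨q, hq⟩ := (PolyBounded.id.add
    (polyBounded_size_gpsiInput hs d (cluster hd i))).poly b
  refine ⟨q, fun n y hy => ?_⟩
  obtain ⟨o, ho, rfl⟩ := (PMF.mem_support_map_iff _ _ _).1 hy
  obtain ⟨r, _, rfl⟩ := (PMF.mem_support_map_iff _ _ _).1 ho
  refine (hb n _ r _).trans (le_trans (le_of_eq ?_) (hq n))
  exact congrArg (fun k => b.eval (n + k)) (Finset.sum_congr (by ext; simp) fun _ _ => rfl)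

theorem size_snoc (l v : Data) : (snoc l v).size = l.size + v.size + 1 := by
  have h := Data.size_ofList_append l.toList [v]
  rw [Data.ofList_toList] at h
  simp only [snoc, Data.ofList, Data.size] at *
  omega

theorem isPolyTime_snoc : IsPolyTime fun x => snoc x.hd x.tl := by
  have h := IsPolyTime.id.hd.append (IsPolyTime.id.tl.node (.const .nil))
  simpa only [snoc, Data.toList] using h

theorem polySized_clientViews (hppt : ∀ d < z, (Γ (2 ^ d)).IsPPT) {s : ℕ → Sets (2 ^ z)}
    (hs : PolyBounded fun n => (enc (s n)).size) (i : Fin (2 ^ z)) (d : ℕ) (hd : d ≤ z) :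
    PolySized fun n => clientViews Γ n (s n) i d hd := by
  induction d with
  | zero =>
    refine ⟨1, fun n y hy => ?_⟩
    have hy := (PMF.mem_support_pure_iff _ _).1 hy
    simp [hy, Data.size]
  | succ d ih =>
    obtain ⟨p, hp⟩ := ih (Nat.le_of_succ_le hd)
    obtain ⟨q, hq⟩ := polySized_idealView hd (hppt d hd) hs i
    refine ⟨p + q + 1, fun n y hy => ?_⟩
    obtain ⟨l, hl, hy⟩ := (PMF.mem_support_bind_iff _ _ _).1 hy
    obtain ⟨v, hv, rfl⟩ := (PMF.mem_support_map_iff _ _ _).1 hy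
    have h1 := hp n l hl
    have h2 := hq n v hv
    rw [size_snoc]
    simp only [Polynomial.eval_add, Polynomial.eval_one]
    omega

/-- The views of a client in the first levels can be simulated from its input and the leakage. -/
theorem exists_simulator_clientViews {L : (k : ℕ) → GSets k → Data}
    (hppt : ∀ d < z, (Γ (2 ^ d)).IsPPT)
    (hsec : ∀ d < z, SecurelyRealizesGPSI U (L (2 ^ d)) (Γ (2 ^ d)))
    (S' : Sets (2 ^ z) → Sets (2 ^ z)) (i : Fin (2 ^ z)) (d : ℕ) (hd : d ≤ z) :
    ∃ A : PPT, ∀ s : ℕ → Sets (2 ^ z), IsInputFamily (Sets.Admissible U) s →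
      EnsIndist (fun n => A.dist
          (enc (n, enc (s n i, S' (s n) i, leakageW (s n) (redundancy (s n)) i))))
        (fun n => clientViews Γ n (s n) i d hd) := by
  induction d with
  | zero =>
    refine ⟨.ofPolyTime (.const .nil), fun s _ => ?_⟩
    simp only [PPT.dist_ofPolyTime]
    exact EnsIndist.refl _
  | succ d ih =>
    obtain ⟨A, hA⟩ := ih (Nat.le_of_succ_le hd)
    obtain ⟨B, hB⟩ := (hsec d hd).2.1 (group d i) (position d i)
    obtain ⟨F, hF, hFeq⟩ := exists_polyTime_ideal hd i
    -- Independently simulate the earlier levels by `A` and the current one by the EG-PSI simulator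
    -- `B`, run on the input and vector that `F` reconstructs; then append.
    refine ⟨(A.pair (B.precomp hF)).postcomp (isPolyTime_snoc.comp IsPolyTime.id.tl),
      fun s hs => ?_⟩
    have hview : EnsIndist
        (fun n => B.dist (enc (n, enc (idealSets (s n) d i, idealVec (s n) hd i))))
        (fun n => idealView Γ n (s n) hd i) := by
      intro D
      have := hB D _ (isInputFamily_idealCluster hs d (cluster hd i))
      simp only [idealCluster_self] at this
      exact this
    have hsize : PolyBounded fun n =>
        (enc (n, enc (idealSets (s n) d i, idealVec (s n) hd i))).size := by
      refine (((PolyBounded.id.const_mul 2).add (hs.2.affine (2 ^ d))).add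
        (hs.2.add (.const 3))).mono fun n => ?_
      have h1 := size_enc_idealSets_le (s n) d i
      have h2 := size_enc_idealVec_le (s n) hd i
      have h3 := size_enc_nat n
      simp only [enc_prod, enc_data, Data.size]
      omega
    have hpair := ((hA s hs).node hview (B.polySized_dist hsize)
      (polySized_clientViews hppt hs.2 i d _)).map_advice (fun _ => .nil) (.const 1)
      (isPolyTime_snoc.comp IsPolyTime.id.tl.tl)
    simp only [PMF.map_bind, PMF.map_comp] at hpair
    simp only [PPT.dist_postcomp, PPT.dist_pair, PPT.dist_precomp, hFeq, PMF.map_bind,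
      PMF.map_comp]
    exact hpair

theorem exists_polyTime_idealOutputs (S' : Sets (2 ^ z) → Sets (2 ^ z)) (i : Fin (2 ^ z)) (d : ℕ)
    (hd : d ≤ z) : ∃ F : Data → Data, IsPolyTime F ∧ ∀ (n : ℕ) (S : Sets (2 ^ z)),
      F (enc (n, enc (S i, S' S i, leakageW S (redundancy S) i))) =
        enc (idealOutputs S i d hd) := by
  induction d with
  | zero => exact ⟨fun _ => .nil, .const _, fun _ _ => rfl⟩
  | succ d ih =>
    obtain ⟨F, hF, hFeq⟩ := ih (Nat.le_of_succ_le hd)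
    obtain ⟨G, hG, hGeq⟩ := exists_polyTime_ideal hd i
    refine ⟨fun x => snoc (F x) (G x).tl.tl, isPolyTime_snoc.comp (hF.node hG.tl.tl), fun n S => ?_⟩
    change snoc (F _) (G _).tl.tl = _
    rw [hFeq, hGeq, idealOutputs, enc_append_singleton]
    rfl

theorem polyBounded_size_idealOutputs {s : ℕ → Sets (2 ^ z)}
    (hs : PolyBounded fun n => (enc (s n)).size) (i : Fin (2 ^ z)) (d : ℕ) (hd : d ≤ z) :
    PolyBounded fun n => (enc (idealOutputs (s n) i d hd)).size := by
  induction d with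
  | zero => exact .const 1
  | succ d ih =>
    refine ((ih (Nat.le_of_succ_le hd)).add ((hs.affine (2 ^ d)).add (.const 1))).mono
      fun n => ?_
    have h := size_enc_idealVec_le (s n) hd i
    rw [idealOutputs, enc_append_singleton, size_snoc]
    omega

/-- The levels of EP-MPD are statistically close to their execution on the ideal sets. -/
theorem exists_statClose_levels {L : (k : ℕ) → GSets k → Data}
    (hsec : ∀ d < z, SecurelyRealizesGPSI U (L (2 ^ d)) (Γ (2 ^ d))) {s : ℕ → Sets (2 ^ z)}
    (hs : IsInputFamily (Sets.Admissible U) s) (d : ℕ) (hd : d ≤ z) :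
    ∃ ε : ℕ → ℝ≥0∞, (∀ n, ε n ≠ ∞) ∧ (Negligible fun n => (ε n).toReal) ∧
      ∀ n, StatClose (levels Γ n (s n) d hd)
        ((idealViews Γ n (s n) d hd).map (idealState (s n) d hd)) (ε n) := by
  induction d with
  | zero =>
    refine ⟨fun _ => 0, by simp, by simpa using negligible_zero, fun n => ?_⟩
    rw [levels, idealViews, PMF.pure_map, idealState, idealSets_zero]
    exact StatClose.refl _
  | succ d ih =>
    obtain ⟨ε, htop, hneg, hclose⟩ := ih (Nat.le_of_succ_le hd)
    have herr : ∀ n, errProb Γ n (s n) d ≠ ∞ := fun n => toOuterMeasure_ne_top _ _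
    refine ⟨fun n => ε n + errProb Γ n (s n) d, fun n => ENNReal.add_ne_top.2 ⟨htop n, herr n⟩,
      ?_, fun n => ?_⟩
    · have hsum : Negligible fun n => ∑ c : Fin (2 ^ z / 2 ^ (d + 1)),
          prob ((Γ (2 ^ d)).exec n (gpsiInput (idealCluster (s n) d c)))
            {o | ¬ ∀ p, (o p).2 = gpsi (idealCluster (s n) d c) p} :=
        Negligible.sum _ fun c _ => (hsec d hd).1 _ (isInputFamily_idealCluster hs d c)
      refine (hneg.add hsum).mono fun n => ?_
      rw [abs_of_nonneg ENNReal.toReal_nonneg, ENNReal.toReal_add (htop n) (herr n)]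
      refine add_le_add_right ?_ _
      unfold prob
      rw [← ENNReal.toReal_sum fun c _ => toOuterMeasure_ne_top _ _]
      exact ENNReal.toReal_mono (ENNReal.sum_ne_top.2 fun c _ => toOuterMeasure_ne_top _ _)
        (errProb_le Γ n (s n) d)
    · have h : (idealViews Γ n (s n) (d + 1) hd).map (idealState (s n) (d + 1) hd) =
          (idealViews Γ n (s n) d (Nat.le_of_succ_le hd)).bind fun vs =>
            (idealLevel Γ n (s n) hd).map fun v =>
              idealState (s n) (d + 1) hd fun i => vs i ++ [v i] := by
        rw [idealViews, PMF.map_bind]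
        simp only [PMF.map_comp, Function.comp_def]
      rw [h]
      -- `statClose_level` applies only to ideal states, so two steps are needed: first the earlier
      -- levels are made ideal with the real level `d` kept, and then level `d` is replaced, now
      -- starting from an ideal state for every sample.
      have hb := (hclose n).bind (g := level Γ n hd) (h := level Γ n hd) (δ := 0)
        fun _ => StatClose.refl _
      intro f hf
      have h1 := hb f hf
      rw [PMF.bind_map] at h1
      have h2 := (StatClose.refl (idealViews Γ n (s n) d (Nat.le_of_succ_le hd))).bind
        (fun vs => statClose_level Γ n (s n) hd vs) f hf
      rw [add_zero] at h1
      rw [zero_add] at h2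
      beta_reduce
      rw [add_comm (ε n)]
      constructor
      · refine h1.1.trans ?_
        rw [← add_assoc]
        gcongr
        exact h2.1
      · refine h2.2.trans ?_
        rw [add_comm (errProb _ _ _ _), ← add_assoc]
        gcongr
        exact h1.2

end Main

end EPMPD

theorem theorem3 (U : ℕ → Set Elem) (Γ : (k : ℕ) → Protocol (GParty k))
    (L : (k : ℕ) → GSets k → Data) (z : ℕ)
    (hppt : ∀ d < z, (Γ (2 ^ d)).IsPPT)
    (hsec : ∀ d < z, SecurelyRealizesGPSI U (L (2 ^ d)) (Γ (2 ^ d))) :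
    SecurelyRealizesPMPD U (fun S => leakageW S (redundancy S)) (epmpd Γ z) := by
  refine ⟨fun S => idealSets S z, isDedup_idealSets, fun s hs => ?_, fun i => ?_⟩
  · obtain ⟨ε, htop, hneg, hclose⟩ := exists_statClose_levels hsec hs z le_rfl
    refine hneg.mono fun n => ?_
    rw [abs_of_nonneg (prob_nonneg _ _)]
    let E : Set (Fin (2 ^ z) → Data × Data) :=
      {o | ¬ ∀ p, (o p).2 = Encode.enc (idealSets (s n) z p)}
    let F : State z → Fin (2 ^ z) → Data × Data := fun st i =>
      (Encode.enc (n, s n i, st.views i, st.outputs i), Encode.enc (st.sets i))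
    have h := ((hclose n).map F).abs_prob_sub_le (htop n) E
    -- In the ideal execution the outputs are correct with certainty.
    have h0 : prob ((((idealViews Γ n (s n) z le_rfl).map (idealState (s n) z le_rfl))).map F) E
        = 0 := by
      rw [prob, PMF.toOuterMeasure_map_apply, PMF.toOuterMeasure_map_apply]
      have : idealState (s n) z le_rfl ⁻¹' (F ⁻¹' E) = ∅ := by
        ext vs
        simp [E, F, idealState]
      rw [this]
      simp
    rw [h0, sub_zero] at h
    exact (le_abs_self _).trans h
  · obtain ⟨A, hA⟩ := exists_simulator_clientViews hppt hsec (fun S => idealSets S z) i z le_rfl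
    obtain ⟨O, hO, hOeq⟩ := exists_polyTime_idealOutputs (fun S => idealSets S z) i z le_rfl
    -- Here `y.hd` is the input of the simulator and `y.tl` the simulated views; `O` recomputes the
    -- outputs of EG-PSI.
    refine ⟨A.postcomp (G := fun y => .node y.hd.hd (.node y.hd.tl.hd (.node y.tl (O y.hd))))
      (.node IsPolyTime.id.hd.hd (.node IsPolyTime.id.hd.tl.hd (.node IsPolyTime.id.tl
        (hO.comp IsPolyTime.id.hd)))), fun D s hs => ?_⟩
    obtain ⟨ε, htop, hneg, hclose⟩ := exists_statClose_levels hsec hs z le_rfl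
    -- For a fixed input family, the set of the client and its ideal outputs are deterministic, so
    -- they can be attached as advice.
    have hsim := (hA s hs).map_advice
      (fun n => .node (Encode.enc (s n i)) (Encode.enc (idealOutputs (s n) i z le_rfl)))
      (((hs.2.add (polyBounded_size_idealOutputs hs.2 i z le_rfl)).add (.const 1)).mono
        fun n => by
          have := size_enc_le_pi (s n) i
          simp only [Data.size]; omega)
      (F := fun x => .node x.hd (.node x.tl.hd.hd (.node x.tl.tl x.tl.hd.tl)))
      (.node IsPolyTime.id.hd (.node IsPolyTime.id.tl.hd.hd (.node IsPolyTime.id.tl.tl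
        IsPolyTime.id.tl.hd.tl)))
    -- Back from the ideal to the real execution, at the cost of the negligible error probability.
    have hreal : EnsIndist
        (fun n => ((idealViews Γ n (s n) z le_rfl).map (idealState (s n) z le_rfl)).map
          fun st => Encode.enc (n, s n i, st.views i, st.outputs i))
        (fun n => (levels Γ n (s n) z le_rfl).map
          fun st => Encode.enc (n, s n i, st.views i, st.outputs i)) := by
      refine EnsIndist.of_statClose (ε := ε) (fun n f hf => ?_) htop hneg
      exact ((hclose n).map _ f hf).symm
    have key := (EnsIndist.trans hsim (Y := _) (by
      simp only [← idealViews_map_eval, PMF.map_comp]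
      simp only [PMF.map_comp] at hreal
      exact hreal)) D
    simp only [PPT.dist_postcomp, epmpd, PMF.map_comp]
    simp only [enc_prod, enc_data, Data.hd_node, Data.tl_node] at key ⊢
    simp only [enc_prod, enc_data] at hOeq
    simpa only [Function.comp_def, hOeq] using key
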